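/- For integers $s_1,\dots,s_k\ge 1$ let $$\zeta_{s_1,\dots,s_k}=\sum_{n_1>\cdots>n_k\ge 1}\frac{1}{n_1^{s_1}\cdots n_k^{s_k}}\quad(s_1\ge 2),\qquad \delta_{s_1,\dots,s_k}=\sum_{n_1>\cdots>n_k\ge 1}\frac{2^{-n_1}}{n_1^{s_1}\cdots n_k^{s_k}},$$ and for $\ell_1,\dots,\ell_r\ge 0$ let $$\mathcal I_{\ell_1\ldots\ell_r}=\frac{1}{\ell_1!\cdots\ell_r!}\int_{\infty>\tau_1>\cdots>\tau_r>0}\ \prod_{i=1}^r\frac{\tau_i^{\ell_i}}{2e^{\tau_i}-1}\,d\tau_1\cdots d\tau_r .$$ Let $A,B$ be elements of a unital associative $\mathbb C$-algebra $\mathcal A$, put $X=[B,A]$, and consider the two series formulae in $\mathcal A[[\hbar]]$ for the Drinfeld associator of the Knizhnik–Zamolodchikov connection: $$\Phi^{\zeta}(A,B)=1+\sum_{r\ge 2}\hbar^r\sum_{\substack{g,\,p_i,\,q_i\ge 1\\ \sum_{i=1}^g(p_i+q_i)=r}}(-1)^{\sum_i q_i}\,\zeta_{p_1+1,\{1\}^{q_1-1},\dots,p_g+1,\{1\}^{q_g-1}}\sum_{\substack{0\le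 s_i\le p_i\\ 0\le t_i\le q_i}}\Big(\prod_{i=1}^g(-1)^{s_i+t_i}\tbinom{p_i}{s_i}\tbinom{q_i}{t_i}\Big)B^{\sum_i t_i}A^{p_1-s_1}B^{q_1-t_1}\cdots A^{p_g-s_g}B^{q_g-t_g}A^{\sum_i s_i},$$ $$\Phi^{\delta}(A,B)=e^{\hbar\ln(2)B}\,\Xi_{B,A}\,(\Xi_{A,B})^{-1}e^{-\hbar\ln(2)A},\qquad \Xi_{B,A}=1+\sum_{r\ge1}\sum_{\ell_1,\dots,\ell_r\ge0}\hbar^{r+\sum_i\ell_i}\,\mathcal I_{\ell_1\ldots\ell_r}\,\mathrm{ad}_B^{\ell_1}(A)\cdots\mathrm{ad}_B^{\ell_r}(A).$$ The series defining $\delta_2,\delta_3,\delta_4,\delta_{2,1},\delta_{3,1},\delta_{2,1,1}$ converge. The $\hbar^4$-coefficients of the two formulae are $$\Phi^{\zeta}_4=\zeta_4\big(\mathrm{ad}_A^2+\mathrm{ad}_B^2\big)(X)+\tfrac12\zeta_2^2X^2+\tfrac14\zeta_4\,[A,[B,X]],$$ $$\Phi^{\delta}_4=\Big(\delta_{2,1,1}+\tfrac16(\ln2)^4+\tfrac12\delta_2(\ln2)^2+\delta_3\ln2+\delta_4\Big)\big(\mathrm{ad}_A^2+\mathrm{ad}_B^2\big)(X)+\tfrac12\zeta_2^2X^2+\Big(2\delta_{3,1}+2\delta_{2,1}\ln2+\tfrac14(\ln2)^4\Big)[A,[B,X]],$$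 and they are equal. When $A,B$ are the free generators of the free associative algebra $\mathbb C\langle A,B\rangle$, the elements $(\mathrm{ad}_A^2+\mathrm{ad}_B^2)(X)$, $X^2$, $[A,[B,X]]$ are linearly independent, so the coefficients may be compared. The coefficients of $[A,[B,X]]$ give $$\tfrac14\zeta_4=2\delta_{3,1}+2\delta_{2,1}\ln2+\tfrac14(\ln2)^4,$$ and those of $(\mathrm{ad}_A^2+\mathrm{ad}_B^2)(X)$ give the $n=2$ case of Hölder convolution, $$\zeta_4=\delta_{2,1,1}+\tfrac16(\ln2)^4+\tfrac12\delta_2(\ln2)^2+\delta_3\ln2+\delta_4 .$$ -/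

import Mathlib

open MeasureTheory

/-! ### Multiple polylogarithms, multiple zeta values and delta values -/

/-- Summation range `n₁ > n₂ > ⋯ > n_k ≥ 1` of a multiple polylogarithm of depth `k`. -/
def DecreasingTuple (k : ℕ) : Type :=
  {n : Fin k → ℕ // StrictAnti n ∧ ∀ i, 1 ≤ n i}

/-- The summand `z₁ ^ n₁ ⋯ z_k ^ n_k / (n₁ ^ s₁ ⋯ n_k ^ s_k)`. -/
noncomputable def multiPolylogTerm (s : List ℕ) (z : Fin s.length → ℝ)
    (n : DecreasingTuple s.length) : ℝ :=
  ∏ i, z i ^ n.1 i / (n.1 i : ℝ) ^ s.get i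

/-- The multiple polylogarithm `Li_{s₁, …, s_k}(z₁, …, z_k)`. -/
noncomputable def multiPolylog (s : List ℕ) (z : Fin s.length → ℝ) : ℝ :=
  ∑' n, multiPolylogTerm s z n

/-- The tuple of arguments `(z, 1, …, 1)`. -/
def singleArg (k : ℕ) (z : ℝ) : Fin k → ℝ := fun i => if i.val = 0 then z else 1

/-- The multiple zeta value `ζ_{s₁, …, s_k}`. -/
noncomputable def mzv (s : List ℕ) : ℝ := multiPolylog s (fun _ => 1)

/-- The delta value `δ_{s₁, …, s_k} = Li_{s₁, …, s_k}(1/2, 1, …, 1)`. -/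
noncomputable def delta (s : List ℕ) : ℝ := multiPolylog s (singleArg s.length (1 / 2))

/-! ### Iterated integrals -/

/-- `∫_a^b ω₁ ⋯ ω_n = ∫_a^b f₁(t) (∫_a^t ω₂ ⋯ ω_n) dt` where `ω_i = f_i(t) dt`. -/
noncomputable def iteratedIntegral : List (ℝ → ℝ) → ℝ → ℝ → ℝ
  | [], _, _ => 1
  | f :: fs, a, b => ∫ t in a..b, f t * iteratedIntegral fs a t

/-- The iterated integral `∫_a^∞ ω₁ ⋯ ω_n`. -/
noncomputable def iteratedIntegralTop : List (ℝ → ℝ) → ℝ → ℝ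
  | [], _ => 1
  | f :: fs, a => ∫ t in Set.Ioi a, f t * iteratedIntegral fs a t

/-- The number `I_{ℓ₁ … ℓ_r}`, that is `1 / (ℓ₁! ⋯ ℓ_r!)` times the iterated integral over
`[0, ∞)` of the forms `t ^ ℓ_i / (2 e ^ t - 1) dt`. -/
noncomputable def deltaIntegral (l : List ℕ) : ℝ :=
  ((l.map fun m => (m.factorial : ℝ)).prod)⁻¹ *
    iteratedIntegralTop (l.map fun m t => t ^ m / (2 * Real.exp t - 1)) 0

/-! ### The two series formulae for the Drinfeld associator, as elements of `𝒜⟦ħ⟧` -/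

section Associator

variable {𝒜 : Type*} [Ring 𝒜] [Algebra ℂ 𝒜]

/-- Exponents `((p₁, q₁), …, (p_g, q_g))`, all at least `1`, with `∑ (p_i + q_i) = r`. -/
def exponentTuples (r g : ℕ) : Finset (Fin g → ℕ × ℕ) :=
  (Fintype.piFinset fun _ => Finset.Icc 1 r ×ˢ Finset.Icc 1 r).filter
    fun e => ∑ i, ((e i).1 + (e i).2) = r

/-- The index `(p₁ + 1, {1}^{q₁ - 1}, …, p_g + 1, {1}^{q_g - 1})`. -/
def mzvIndex {g : ℕ} (e : Fin g → ℕ × ℕ) : List ℕ :=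
  (List.ofFn fun i => ((e i).1 + 1) :: List.replicate ((e i).2 - 1) 1).flatten

/-- The noncommutative polynomial
`∑_{s, t} ∏ (-1)^{s_i + t_i} (p_i choose s_i) (q_i choose t_i) •`
`B^{∑ t} A^{p₁ - s₁} B^{q₁ - t₁} ⋯ A^{p_g - s_g} B^{q_g - t_g} A^{∑ s}`,
summed over `0 ≤ s_i ≤ p_i` and `0 ≤ t_i ≤ q_i`. -/
def mzvMonomialSum {g : ℕ} (A B : 𝒜) (e : Fin g → ℕ × ℕ) : 𝒜 :=
  ∑ s ∈ Fintype.piFinset fun i => Finset.range ((e i).1 + 1),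
    ∑ t ∈ Fintype.piFinset fun i => Finset.range ((e i).2 + 1),
      (∏ i, (-1 : ℤ) ^ (s i + t i) * ((e i).1.choose (s i)) * ((e i).2.choose (t i))) •
        (B ^ (∑ i, t i) *
          (List.ofFn fun i => A ^ ((e i).1 - s i) * B ^ ((e i).2 - t i)).prod *
          A ^ (∑ i, s i))

/-- The series formula for the associator whose coefficients are multiple zeta values. -/
noncomputable def associatorMZV (A B : 𝒜) : PowerSeries 𝒜 :=
  1 + PowerSeries.mk fun r =>
    ∑ g ∈ Finset.Icc 1 r, ∑ e ∈ exponentTuples r g,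
      (((-1 : ℝ) ^ (∑ i, (e i).2) * mzv (mzvIndex e) : ℝ) : ℂ) • mzvMonomialSum A B e

/-- The series `e ^ {ħ a A}`. -/
noncomputable def expSeries (a : ℝ) (A : 𝒜) : PowerSeries 𝒜 :=
  PowerSeries.mk fun n => ((a ^ n / n.factorial : ℝ) : ℂ) • A ^ n

/-- The iterated commutator `ad_B^l(A) = [B, [B, … [B, A]]]`. -/
def adPow (B : 𝒜) (l : ℕ) (A : 𝒜) : 𝒜 := (fun Y => ⁅B, Y⁆)^[l] A

/-- The series `Ξ_{B,A} = 1 + ∑_{r ≥ 1} ∑_{ℓ₁, …, ℓ_r ≥ 0} ħ^{r + ∑ ℓ_i} I_{ℓ₁ … ℓ_r}`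
`ad_B^{ℓ₁}(A) ⋯ ad_B^{ℓ_r}(A)`. The tuples contributing to `ħ ^ n` are the compositions
`(ℓ₁ + 1, …, ℓ_r + 1)` of `n`; the empty one gives the constant term `1`. -/
noncomputable def xiSeries (B A : 𝒜) : PowerSeries 𝒜 :=
  PowerSeries.mk fun n => ∑ κ : Composition n,
    (deltaIntegral (κ.blocks.map fun m => m - 1) : ℂ) •
      (κ.blocks.map fun m => adPow B (m - 1) A).prod

/-- The series formula `e^{ħ ln(2) B} Ξ_{B,A} (Ξ_{A,B})⁻¹ e^{-ħ ln(2) A}` for the associator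
(the constant coefficient of `Ξ_{A,B}` is `1`, so that `Ξ_{A,B}` is invertible). -/
noncomputable def associatorDelta (A B : 𝒜) : PowerSeries 𝒜 :=
  expSeries (Real.log 2) B * xiSeries B A * PowerSeries.invOfUnit (xiSeries A B) 1 *
    expSeries (-Real.log 2) A

end Associator

/-! ### Nested sums and one-variable multiple polylogarithms -/

/-! Both fourth-order terms are computed explicitly, and the numerical identities that match them
are proved independently, by one-variable calculus on `polylog`, the series Li_s(x, 1, …, 1). Its
derivative is Li_{s-1,…}(x)/x, or Li_{…}(x)/(1-x) when the leading index is 1 (`hasDerivAt_polylog`,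
`hasDerivAt_polylog_one`).

Numerical identities: `polylog_four_holder` and `polylog_three_one_holder` exhibit functions on
(0,1) with zero derivative. Their limit at 1 is ζ_4, respectively ζ_{3,1}, while their value at 1/2
is an expression in delta values and ln 2. Letting x tend to 0 in the first gives the duality
ζ_{2,1,1} = ζ_4. Stuffle and shuffle products of ζ_2 with itself give 4ζ_{3,1} = ζ_4, and Euler's
values give ζ_2² = (5/2)ζ_4, hence ζ_{2,2} = (3/4)ζ_4.

Zeta side: only the four zeta values ζ_4, ζ_{3,1}, ζ_{2,2}, ζ_{2,1,1} occur in degree 4, all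
rational multiples of ζ_4, so the claim is an identity between noncommutative words
(`coeff_four_associatorMZV`).

Delta side: with x = e^{-t}/2 one has 1/(2e^t-1) = x/(1-x), and termwise integration gives ∫
t^m/(2e^t-1) Li_s(x) dt = m! δ_{m+1,s} (`integral_pow_div_mul_polylog`). This settles the words (m),
(m,0), (m,0,0); the shuffle product `expIntegral_mul` yields the other words of degree at most 4.
The associator is then found degree by degree from Φ · e^{ħ ln(2) A} Ξ_{A,B} = e^{ħ ln(2) B}
Ξ_{B,A}, without expanding an inverse (`coeff_four_associatorDelta`). -/

/-- The nested sum over `n > n₁ > ⋯ > n_k ≥ 1` of `1 / (n₁ ^ s₁ ⋯ n_k ^ s_k)`. -/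
noncomputable def nestedSum : List ℕ → ℕ → ℝ
  | [], _ => 1
  | s :: ss, n => ∑ m ∈ Finset.Ico 1 n, nestedSum ss m / (m : ℝ) ^ s

/-- The coefficient of `x ^ (n + 1)` in `Li_{s, ss}(x, 1, …, 1)`. -/
noncomputable def liCoeff (s : ℕ) (ss : List ℕ) (n : ℕ) : ℝ :=
  nestedSum ss (n + 1) / ((n : ℝ) + 1) ^ s

/-- The multiple polylogarithm `Li_{s₁, …, s_k}(x, 1, …, 1)` as a power series in `x`. -/
noncomputable def polylog : List ℕ → ℝ → ℝ
  | [], _ => 1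
  | s :: ss, x => ∑' n, liCoeff s ss n * x ^ (n + 1)

theorem nestedSum_nonneg (ss : List ℕ) (n : ℕ) : 0 ≤ nestedSum ss n := by
  induction ss generalizing n with
  | nil => simp [nestedSum]
  | cons s ss ih => exact Finset.sum_nonneg fun m _ => div_nonneg (ih m) (by positivity)

theorem nestedSum_le (ss : List ℕ) (n : ℕ) : nestedSum ss n ≤ (n : ℝ) ^ ss.length := by
  induction ss generalizing n with
  | nil => simp [nestedSum]
  | cons s ss ih =>
    have h : ∀ m ∈ Finset.Ico 1 n, nestedSum ss m / (m : ℝ) ^ s ≤ (n : ℝ) ^ ss.length := by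
      intro m hm
      rw [Finset.mem_Ico] at hm
      have h1 : (1 : ℝ) ≤ m := by exact_mod_cast hm.1
      calc nestedSum ss m / (m : ℝ) ^ s ≤ nestedSum ss m :=
            div_le_self (nestedSum_nonneg _ _) (one_le_pow₀ h1)
        _ ≤ (m : ℝ) ^ ss.length := ih m
        _ ≤ (n : ℝ) ^ ss.length := by
            gcongr
            exact hm.2.le
    calc nestedSum (s :: ss) n ≤ ∑ _m ∈ Finset.Ico 1 n, (n : ℝ) ^ ss.length :=
          Finset.sum_le_sum h
      _ = ((n - 1 : ℕ) : ℝ) * (n : ℝ) ^ ss.length := by simp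
      _ ≤ (n : ℝ) * (n : ℝ) ^ ss.length := by
          gcongr
          omega
      _ = _ := by rw [List.length_cons, pow_succ']

theorem liCoeff_nonneg (s : ℕ) (ss : List ℕ) (n : ℕ) : 0 ≤ liCoeff s ss n :=
  div_nonneg (nestedSum_nonneg _ _) (by positivity)

theorem liCoeff_le (s : ℕ) (ss : List ℕ) (n : ℕ) :
    liCoeff s ss n ≤ ((n : ℝ) + 1) ^ ss.length := by
  have h : (1 : ℝ) ≤ (n : ℝ) + 1 := by simp
  calc liCoeff s ss n ≤ nestedSum ss (n + 1) :=
        div_le_self (nestedSum_nonneg _ _) (one_le_pow₀ h)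
    _ ≤ _ := by simpa using nestedSum_le ss (n + 1)

/-! ### Sums over decreasing tuples as iterated sums. -/

theorem hasSum_sigma_of_nonneg {ι : Type*} {γ : ι → Type*} {f : (Σ i, γ i) → ℝ} {g : ι → ℝ}
    {a : ℝ} (hf : ∀ p, 0 ≤ f p) (h : ∀ i, HasSum (fun c => f ⟨i, c⟩) (g i)) (hg : HasSum g a) :
    HasSum f a := by
  have hs : Summable f := by
    rw [summable_sigma_of_nonneg hf]
    refine ⟨fun i => (h i).summable, ?_⟩
    simpa only [(h _).tsum_eq] using hg.summable
  have := hs.hasSum.sigma h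
  rw [← this.unique hg]
  exact hs.hasSum

/-- Strictly decreasing tuples with entries in `[1, n)`. -/
def BoundedTuple (k n : ℕ) : Type :=
  {f : Fin k → ℕ // StrictAnti f ∧ ∀ i, 1 ≤ f i ∧ f i < n}

theorem strictAnti_cons {k m : ℕ} {f : Fin k → ℕ} :
    StrictAnti (Fin.cons m f : Fin (k + 1) → ℕ) ↔ StrictAnti f ∧ ∀ i, f i < m := by
  constructor
  · intro h
    refine ⟨fun i j hij => ?_, fun i => ?_⟩
    · simpa using h (Fin.succ_lt_succ_iff.2 hij)
    · simpa using h (Fin.succ_pos i)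
  · rintro ⟨h, hm⟩ i j hij
    induction i using Fin.cases with
    | zero =>
      induction j using Fin.cases with
      | zero => exact absurd hij (lt_irrefl _)
      | succ j => simpa using hm j
    | succ i =>
      induction j using Fin.cases with
      | zero => exact absurd hij (by simp)
      | succ j => simpa using h (Fin.succ_lt_succ_iff.1 hij)

/-- Splitting off the first entry of a bounded decreasing tuple. -/
def boundedTupleEquiv (k n : ℕ) :
    (Σ m : Finset.Ico 1 n, BoundedTuple k m) ≃ BoundedTuple (k + 1) n where
  toFun p := ⟨Fin.cons p.1.1 p.2.1, strictAnti_cons.2 ⟨p.2.2.1, fun i => (p.2.2.2 i).2⟩,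
    Fin.cases (Finset.mem_Ico.1 p.1.2) fun i => by
      have h1 := p.2.2.2 i
      have h2 := (Finset.mem_Ico.1 p.1.2).2
      exact ⟨by simpa using h1.1, by simpa using h1.2.trans h2⟩⟩
  invFun f := ⟨⟨f.1 0, Finset.mem_Ico.2 (f.2.2 0)⟩, Fin.tail f.1,
    fun i j hij => f.2.1 (Fin.succ_lt_succ_iff.2 hij),
    fun i => ⟨(f.2.2 i.succ).1, f.2.1 (Fin.succ_pos i)⟩⟩
  left_inv p := rfl
  right_inv f := Subtype.ext (Fin.cons_self_tail f.1)

/-- Splitting off the first entry of a decreasing tuple. -/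
def decreasingTupleEquiv (k : ℕ) :
    (Σ n : ℕ, BoundedTuple k (n + 1)) ≃ DecreasingTuple (k + 1) where
  toFun p := ⟨Fin.cons (p.1 + 1) p.2.1, strictAnti_cons.2 ⟨p.2.2.1, fun i => (p.2.2.2 i).2⟩,
    Fin.cases (by simp) fun i => by simpa using (p.2.2.2 i).1⟩
  invFun f := ⟨f.1 0 - 1, Fin.tail f.1,
    fun i j hij => f.2.1 (Fin.succ_lt_succ_iff.2 hij),
    fun i => ⟨f.2.2 i.succ, by
      rw [Nat.sub_add_cancel (f.2.2 0)]
      exact f.2.1 (Fin.succ_pos i)⟩⟩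
  left_inv p := rfl
  right_inv f := by
    refine Subtype.ext ?_
    change (Fin.cons (f.1 0 - 1 + 1) (Fin.tail f.1) : Fin (k + 1) → ℕ) = f.1
    rw [Nat.sub_add_cancel (f.2.2 0)]
    exact Fin.cons_self_tail f.1

theorem hasSum_boundedTuple (ss : List ℕ) (n : ℕ) :
    HasSum (fun f : BoundedTuple ss.length n => ∏ i, 1 / (f.1 i : ℝ) ^ ss.get i)
      (nestedSum ss n) := by
  induction ss generalizing n with
  | nil =>
    let _ : Unique (BoundedTuple ([] : List ℕ).length n) :=
      { default := ⟨Fin.elim0, fun i => i.elim0, fun i => i.elim0⟩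
        uniq := fun f => Subtype.ext (funext fun i => i.elim0) }
    simp [nestedSum]
  | cons s ss ih =>
    refine (boundedTupleEquiv ss.length n).hasSum_iff.1 ?_
    refine hasSum_sigma_of_nonneg (γ := fun m : Finset.Ico 1 n => BoundedTuple ss.length m)
      (g := fun m : Finset.Ico 1 n => nestedSum ss m / ((m : ℕ) : ℝ) ^ s) ?_ ?_ ?_
    · intro p
      exact Finset.prod_nonneg fun i _ => by positivity
    · rintro m
      convert! (ih m.1).mul_left (1 / (m.1 : ℝ) ^ s) using 1
      · funext f
        exact Fin.prod_univ_succ _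
      · ring
    · have := hasSum_fintype (fun m : Finset.Ico 1 n => nestedSum ss m / ((m : ℕ) : ℝ) ^ s)
      rwa [Finset.sum_coe_sort (Finset.Ico 1 n) (fun m => nestedSum ss m / (m : ℝ) ^ s)] at this

theorem multiPolylogTerm_singleArg_nonneg {s : List ℕ} {z : ℝ} (hz : 0 ≤ z)
    (n : DecreasingTuple s.length) : 0 ≤ multiPolylogTerm s (singleArg s.length z) n := by
  refine Finset.prod_nonneg fun i _ => div_nonneg (pow_nonneg ?_ _) (by positivity)
  unfold singleArg
  split_ifs
  · exact hz
  · exact zero_le_one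

/-- Only the largest index carries the variable z. Splitting it off as n + 1 leaves a finite sum
over the remaining indices, namely `nestedSum ss (n + 1)`; nonnegativity of the terms justifies the
rearrangement. -/
theorem hasSum_multiPolylogTerm {s : ℕ} {ss : List ℕ} {z a : ℝ} (hz : 0 ≤ z)
    (h : HasSum (fun n => liCoeff s ss n * z ^ (n + 1)) a) :
    HasSum (multiPolylogTerm (s :: ss) (singleArg (s :: ss).length z)) a := by
  refine (decreasingTupleEquiv ss.length).hasSum_iff.1 ?_
  refine hasSum_sigma_of_nonneg ?_ ?_ h
  · exact fun p => multiPolylogTerm_singleArg_nonneg hz _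
  · intro n
    convert! (hasSum_boundedTuple ss (n + 1)).mul_left (z ^ (n + 1) / ((n : ℝ) + 1) ^ s) using 1
    · funext f
      refine (Fin.prod_univ_succ _).trans ?_
      congr 1
      · change singleArg _ z 0 ^ (n + 1) / ((n + 1 : ℕ) : ℝ) ^ s = _
        simp [singleArg]
      · refine Finset.prod_congr rfl fun i _ => ?_
        change singleArg _ z i.succ ^ (f.1 i) / ((f.1 i : ℕ) : ℝ) ^ ss.get i = _
        simp [singleArg]
    · rw [liCoeff]
      ring

theorem hasSum_polylog {s : ℕ} {ss : List ℕ} {z : ℝ}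
    (h : Summable fun n => liCoeff s ss n * z ^ (n + 1)) :
    HasSum (fun n => liCoeff s ss n * z ^ (n + 1)) (polylog (s :: ss) z) :=
  h.hasSum

theorem multiPolylog_singleArg {s : ℕ} {ss : List ℕ} {z : ℝ} (hz : 0 ≤ z)
    (h : Summable fun n => liCoeff s ss n * z ^ (n + 1)) :
    multiPolylog (s :: ss) (singleArg (s :: ss).length z) = polylog (s :: ss) z :=
  (hasSum_multiPolylogTerm hz (hasSum_polylog h)).tsum_eq

theorem summable_polylog (s : ℕ) (ss : List ℕ) {x : ℝ} (hx : |x| < 1) :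
    Summable fun n => liCoeff s ss n * x ^ (n + 1) := by
  have h1 := summable_pow_mul_geometric_of_norm_lt_one (R := ℝ) ss.length
    (r := |x|) (by simpa using hx)
  have h2 := (summable_nat_add_iff 1).2 h1
  refine Summable.of_norm_bounded h2 fun n => ?_
  rw [norm_mul, Real.norm_of_nonneg (liCoeff_nonneg _ _ _), norm_pow, Real.norm_eq_abs]
  push_cast
  gcongr
  exact liCoeff_le s ss n

theorem delta_cons (s : ℕ) (ss : List ℕ) : delta (s :: ss) = polylog (s :: ss) (1 / 2) :=
  multiPolylog_singleArg (by norm_num) (summable_polylog s ss (by norm_num [abs_of_pos]))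

theorem mzv_cons {s : ℕ} {ss : List ℕ} (h : Summable (liCoeff s ss)) :
    mzv (s :: ss) = polylog (s :: ss) 1 := by
  have h1 : (fun _ => 1 : Fin (s :: ss).length → ℝ) = singleArg (s :: ss).length 1 := by
    funext i
    simp [singleArg]
  rw [mzv, h1]
  exact multiPolylog_singleArg zero_le_one (by simpa using h)

/-! ### Analytic properties of multiple polylogarithms -/

open Filter Topology

/-- Termwise differentiation on a ball of radius r with |x| < r < 1, where |a n| r^n dominates the
derivatives. -/
theorem hasDerivAt_tsum_div_mul_pow {a : ℕ → ℝ}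
    (ha : ∀ x : ℝ, |x| < 1 → Summable fun n => a n * x ^ n) {x : ℝ} (hx : |x| < 1) :
    HasDerivAt (fun y => ∑' n, a n / ((n : ℝ) + 1) * y ^ (n + 1)) (∑' n, a n * x ^ n) x := by
  obtain ⟨r, hxr, hr⟩ := exists_between hx
  have hr0 : 0 < r := (abs_nonneg x).trans_lt hxr
  have hu : Summable fun n => |a n| * r ^ n := by
    refine (ha r (by rwa [abs_of_pos hr0])).abs.congr fun n => ?_
    rw [abs_mul, abs_of_nonneg (pow_nonneg hr0.le n)]
  refine hasDerivAt_tsum_of_isPreconnected hu (t := Metric.ball 0 r) Metric.isOpen_ball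
    (convex_ball (0 : ℝ) r).isPreconnected (g := fun n y => a n / ((n : ℝ) + 1) * y ^ (n + 1))
    (g' := fun n y => a n * y ^ n) (y₀ := 0) ?_ ?_ (Metric.mem_ball_self hr0) ?_ ?_
  · intro n y _
    have h := (hasDerivAt_pow (n + 1) y).const_mul (a n / ((n : ℝ) + 1))
    convert! h using 1
    have : (n : ℝ) + 1 ≠ 0 := by positivity
    push_cast
    field_simp
  · intro n y hy
    have hy' : |y| < r := by simpa using hy
    rw [norm_mul, norm_pow, Real.norm_eq_abs, Real.norm_eq_abs]
    gcongr
  · simp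
  · simpa using hxr

theorem summable_liCoeff_mul_pow (s : ℕ) (ss : List ℕ) {x : ℝ} (hx : |x| < 1) :
    Summable fun n => liCoeff s ss n * x ^ n := by
  rcases eq_or_ne x 0 with rfl | h0
  · exact summable_of_ne_finset_zero (s := {0}) fun n hn => by simp_all
  · refine ((summable_polylog s ss hx).mul_left x⁻¹).congr fun n => ?_
    field_simp
    ring

theorem liCoeff_succ (s : ℕ) (ss : List ℕ) (n : ℕ) :
    liCoeff (s + 1) ss n = liCoeff s ss n / ((n : ℝ) + 1) := by
  rw [liCoeff, liCoeff, pow_succ, div_div]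

theorem hasDerivAt_polylog_tsum (s : ℕ) (ss : List ℕ) {x : ℝ} (hx : |x| < 1) :
    HasDerivAt (polylog ((s + 1) :: ss)) (∑' n, liCoeff s ss n * x ^ n) x := by
  have h := hasDerivAt_tsum_div_mul_pow
    (fun y hy => summable_liCoeff_mul_pow s ss hy) hx
  simp only [← liCoeff_succ] at h
  exact h

theorem hasDerivAt_polylog (s : ℕ) (ss : List ℕ) {x : ℝ} (hx : |x| < 1) (h0 : x ≠ 0) :
    HasDerivAt (polylog ((s + 1) :: ss)) (polylog (s :: ss) x / x) x := by
  convert! hasDerivAt_polylog_tsum s ss hx using 1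
  rw [polylog, div_eq_inv_mul, ← tsum_mul_left]
  refine tsum_congr fun n => ?_
  field_simp
  ring

/-- For nonempty `ss` the nested sums are partial sums of the coefficients of Li_ss, and taking
partial sums multiplies a generating function by 1/(1-x). This is the source of the derivative
formula for a leading index 1. -/
theorem tsum_nestedSum_mul_pow (ss : List ℕ) {x : ℝ} (hx : |x| < 1) :
    HasSum (fun n => nestedSum ss (n + 1) * x ^ n) (polylog ss x / (1 - x)) := by
  have hx1 : 1 - x ≠ 0 := by linarith [(abs_lt.1 hx).2]
  have h0 := summable_liCoeff_mul_pow 0 ss hx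
  simp only [liCoeff, pow_zero, div_one] at h0
  cases ss with
  | nil =>
    simpa [nestedSum, polylog] using hasSum_geometric_of_abs_lt_one hx
  | cons s ss =>
    have h1 : HasSum (fun n => nestedSum (s :: ss) (n + 1 + 1) * x ^ (n + 1))
        (x * (∑' n, nestedSum (s :: ss) (n + 1) * x ^ n) + polylog (s :: ss) x) := by
      refine ((h0.hasSum.mul_left x).add
        (hasSum_polylog (summable_polylog s ss hx))).congr_fun ?_
      intro n
      rw [liCoeff, nestedSum, nestedSum, Finset.sum_Ico_succ_top (by omega)]
      push_cast
      ring
    have h2 := h0.tsum_eq_zero_add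
    rw [h1.tsum_eq] at h2
    -- The sum over `Ico 1 1` is empty, so the shifted series has no constant term.
    have h3 : nestedSum (s :: ss) (0 + 1) = 0 := by simp [nestedSum]
    rw [h3] at h2
    convert! h0.hasSum using 1
    rw [div_eq_iff hx1]
    linarith

theorem hasDerivAt_polylog_one (ss : List ℕ) {x : ℝ} (hx : |x| < 1) :
    HasDerivAt (polylog (1 :: ss)) (polylog ss x / (1 - x)) x := by
  convert! hasDerivAt_polylog_tsum 0 ss hx using 1
  rw [← (tsum_nestedSum_mul_pow ss hx).tsum_eq]
  simp [liCoeff]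

theorem polylog_zero (s : ℕ) (ss : List ℕ) : polylog (s :: ss) 0 = 0 := by
  simp [polylog]

theorem eq_of_hasDerivAt_Ioo {f g f' : ℝ → ℝ} {a b : ℝ}
    (hf : ∀ x ∈ Set.Ioo a b, HasDerivAt f (f' x) x)
    (hg : ∀ x ∈ Set.Ioo a b, HasDerivAt g (f' x) x) {x y : ℝ}
    (hx : x ∈ Set.Ioo a b) (hy : y ∈ Set.Ioo a b) (h : f y = g y) : f x = g x := by
  have hd : ∀ z ∈ Set.Ioo a b, HasDerivAt (fun z => f z - g z) 0 z := fun z hz => by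
    simpa using (hf z hz).fun_sub (hg z hz)
  have := isOpen_Ioo.is_const_of_deriv_eq_zero isPreconnected_Ioo
    (fun z hz => (hd z hz).differentiableAt.differentiableWithinAt)
    (fun z hz => (hd z hz).deriv) hx hy
  simp only [h, sub_self] at this
  linarith

theorem polylog_one {x : ℝ} (hx : |x| < 1) : polylog [1] x = -Real.log (1 - x) := by
  rw [← (Real.hasSum_pow_div_log_of_abs_lt_one hx).tsum_eq, polylog]
  refine tsum_congr fun n => ?_
  rw [liCoeff, nestedSum, pow_one]
  ring

theorem hasDerivAt_neg_log_one_sub {x : ℝ} (hx : |x| < 1) :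
    HasDerivAt (fun y => -Real.log (1 - y)) (1 / (1 - x)) x := by
  have hx1 : 1 - x ≠ 0 := by linarith [(abs_lt.1 hx).2]
  convert! (((hasDerivAt_id x).const_sub 1).log hx1).neg using 1
  simp [neg_div]

theorem polylog_one_one {x : ℝ} (hx : |x| < 1) :
    polylog [1, 1] x = Real.log (1 - x) ^ 2 / 2 := by
  refine eq_of_hasDerivAt_Ioo (a := -1) (b := 1)
    (g := fun x => Real.log (1 - x) ^ 2 / 2)
    (fun y hy => hasDerivAt_polylog_one [1] (abs_lt.2 hy)) (fun y hy => ?_) (abs_lt.1 hx)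
    (y := 0) (by simp) (by simp [polylog_zero])
  rw [polylog_one (abs_lt.2 hy)]
  have h := ((hasDerivAt_neg_log_one_sub (abs_lt.2 hy)).fun_pow 2).div_const 2
  simp only [neg_sq] at h
  convert! h using 1
  ring

theorem polylog_one_one_one {x : ℝ} (hx : |x| < 1) :
    polylog [1, 1, 1] x = -Real.log (1 - x) ^ 3 / 6 := by
  refine eq_of_hasDerivAt_Ioo (a := -1) (b := 1)
    (g := fun x => -Real.log (1 - x) ^ 3 / 6)
    (fun y hy => hasDerivAt_polylog_one [1, 1] (abs_lt.2 hy)) (fun y hy => ?_) (abs_lt.1 hx)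
    (y := 0) (by simp) (by simp [polylog_zero])
  rw [polylog_one_one (abs_lt.2 hy)]
  have h := ((hasDerivAt_neg_log_one_sub (abs_lt.2 hy)).fun_pow 3).div_const 6
  have e : ∀ y : ℝ, (-Real.log (1 - y)) ^ 3 = -Real.log (1 - y) ^ 3 := fun y => by ring
  simp only [e] at h
  convert! h using 1
  ring

theorem polylog_nonneg (ss : List ℕ) {x : ℝ} (hx : 0 ≤ x) : 0 ≤ polylog ss x := by
  cases ss with
  | nil => simp [polylog]
  | cons s ss => exact tsum_nonneg fun n => mul_nonneg (liCoeff_nonneg _ _ _) (by positivity)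

theorem liCoeff_succ_le (s : ℕ) (ss : List ℕ) (n : ℕ) :
    liCoeff (s + 1) ss n ≤ liCoeff s ss n := by
  rw [liCoeff_succ]
  exact div_le_self (liCoeff_nonneg _ _ _) (by simp)

theorem polylog_succ_le (s : ℕ) (ss : List ℕ) {x : ℝ} (hx : 0 ≤ x) (hx1 : x < 1) :
    polylog ((s + 1) :: ss) x ≤ polylog (s :: ss) x := by
  have h : |x| < 1 := by rwa [abs_of_nonneg hx]
  refine (summable_polylog _ _ h).tsum_le_tsum (fun n => ?_) (summable_polylog _ _ h)
  gcongr
  exact liCoeff_succ_le s ss n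

theorem continuousOn_polylog {s : ℕ} {ss : List ℕ} (h : Summable (liCoeff s ss)) :
    ContinuousOn (polylog (s :: ss)) (Set.Icc 0 1) := by
  refine continuousOn_tsum (u := liCoeff s ss) (fun n => by fun_prop) h fun n x hx => ?_
  rw [norm_mul, Real.norm_of_nonneg (liCoeff_nonneg _ _ _), norm_pow,
    Real.norm_of_nonneg hx.1]
  exact mul_le_of_le_one_right (liCoeff_nonneg _ _ _) (pow_le_one₀ hx.1 hx.2)

theorem tendsto_polylog_one {s : ℕ} {ss : List ℕ} (h : Summable (liCoeff s ss)) :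
    Tendsto (polylog (s :: ss)) (𝓝[<] 1) (𝓝 (polylog (s :: ss) 1)) := by
  have h1 := continuousOn_polylog h 1 (by simp)
  rw [← nhdsWithin_Ico_eq_nhdsLT (zero_lt_one' ℝ)]
  exact h1.mono_left (nhdsWithin_mono _ Set.Ico_subset_Icc_self)

theorem tendsto_polylog_zero (s : ℕ) (ss : List ℕ) :
    Tendsto (polylog ((s + 1) :: ss)) (𝓝 0) (𝓝 0) := by
  have := (hasDerivAt_polylog_tsum s ss (x := 0) (by simp)).continuousAt.tendsto
  rwa [polylog_zero] at this

/-- Nonnegative coefficients are summable if the power series is bounded on `(0, 1)`. -/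
theorem summable_of_tsum_mul_pow_le {a : ℕ → ℝ} {C : ℝ} (ha : ∀ n, 0 ≤ a n)
    (hs : ∀ x ∈ Set.Ioo (0 : ℝ) 1, Summable fun n => a n * x ^ (n + 1))
    (hC : ∀ x ∈ Set.Ioo (0 : ℝ) 1, ∑' n, a n * x ^ (n + 1) ≤ C) : Summable a := by
  refine summable_of_sum_range_le (c := C) ha fun N => ?_
  -- A finite partial sum is a polynomial in x, so the bound on (0,1) passes to x = 1.
  have hc : Tendsto (fun x : ℝ => ∑ n ∈ Finset.range N, a n * x ^ (n + 1)) (𝓝[<] 1)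
      (𝓝 (∑ n ∈ Finset.range N, a n * 1 ^ (n + 1))) := by
    refine Tendsto.mono_left (Continuous.tendsto ?_ 1) nhdsWithin_le_nhds
    fun_prop
  simp only [one_pow, mul_one] at hc
  refine le_of_tendsto hc ?_
  filter_upwards [Ioo_mem_nhdsLT (zero_lt_one' ℝ)] with x hx
  refine le_trans ((hs x hx).sum_le_tsum _ fun n _ => ?_) (hC x hx)
  exact mul_nonneg (ha n) (pow_nonneg hx.1.le _)

/-! ### Relations between multiple zeta values and delta values -/

/-- The constant is read off from a limit at an endpoint, where individual terms such as log x or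
log (1-x) may be singular. -/
theorem eq_of_hasDerivAt_zero_of_tendsto {f : ℝ → ℝ} {l : Filter ℝ} [l.NeBot] {c : ℝ}
    (hl : ∀ᶠ x in l, x ∈ Set.Ioo (0 : ℝ) 1) (hd : ∀ x ∈ Set.Ioo (0 : ℝ) 1, HasDerivAt f 0 x)
    (ht : Tendsto f l (𝓝 c)) {x : ℝ} (hx : x ∈ Set.Ioo (0 : ℝ) 1) : f x = c := by
  have h : ∀ᶠ y in l, f y = f x := by
    filter_upwards [hl] with y hy
    exact isOpen_Ioo.is_const_of_deriv_eq_zero isPreconnected_Ioo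
      (fun z hz => (hd z hz).differentiableAt.differentiableWithinAt)
      (fun z hz => (hd z hz).deriv) hy hx
  exact tendsto_nhds_unique (tendsto_const_nhds.congr' (h.mono fun y hy => hy.symm)) ht

theorem tendsto_log_pow_mul_nhdsGT_zero (k : ℕ) :
    Tendsto (fun y : ℝ => Real.log y ^ k * y) (𝓝[>] 0) (𝓝 0) := by
  have h := (Real.tendsto_pow_log_div_mul_add_atTop 1 0 k one_ne_zero).comp
    (tendsto_inv_nhdsGT_zero (𝕜 := ℝ))
  have h2 := h.const_mul ((-1) ^ k)
  rw [mul_zero] at h2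
  refine h2.congr fun y => ?_
  simp only [Function.comp, Real.log_inv, neg_pow (Real.log y), one_mul, add_zero, div_inv_eq_mul]
  rw [← mul_assoc, ← mul_assoc, ← mul_pow]
  norm_num

theorem tendsto_one_sub_nhdsLT : Tendsto (fun x : ℝ => 1 - x) (𝓝[<] 1) (𝓝[>] 0) := by
  refine tendsto_nhdsWithin_of_tendsto_nhds_of_eventually_within _ ?_ ?_
  · refine Tendsto.mono_left ?_ nhdsWithin_le_nhds
    exact (by fun_prop : Continuous fun x : ℝ => 1 - x).tendsto' 1 0 (sub_self 1)
  · filter_upwards [self_mem_nhdsWithin] with x hx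
    simpa using hx

theorem eventually_mem_Ioo_nhdsLT_one : ∀ᶠ x : ℝ in 𝓝[<] 1, x ∈ Set.Ioo (0 : ℝ) 1 :=
  Ioo_mem_nhdsLT (zero_lt_one' ℝ)

/-- Near 1 one has |log x| ≤ 2(1-x), from log x ≥ 1 - 1/x and 1/x ≤ 2, and the factor 1-x beats any
power of log (1-x). -/
theorem tendsto_log_mul_log_one_sub_pow (k : ℕ) :
    Tendsto (fun x : ℝ => Real.log x * Real.log (1 - x) ^ k) (𝓝[<] 1) (𝓝 0) := by
  have h1 : Tendsto (fun x : ℝ => -((1 - x) / x)) (𝓝[<] 1) (𝓝 0) := by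
    refine Tendsto.mono_left ?_ nhdsWithin_le_nhds
    have : ContinuousAt (fun x : ℝ => -((1 - x) / x)) 1 :=
      ((continuousAt_const.sub continuousAt_id).div continuousAt_id one_ne_zero).neg
    simpa using this.tendsto
  have h2 := ((tendsto_log_pow_mul_nhdsGT_zero k).comp tendsto_one_sub_nhdsLT).abs.const_mul 2
  simp only [abs_zero, mul_zero] at h2
  refine squeeze_zero_norm' ?_ h2
  filter_upwards [Ioo_mem_nhdsLT (by norm_num : (1 / 2 : ℝ) < 1)] with x hx
  have hx0 : 0 < x := by linarith [hx.1]
  have h3 : |Real.log x| ≤ 2 * (1 - x) := by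
    rw [abs_of_nonpos (Real.log_nonpos hx0.le hx.2.le)]
    have h4 := Real.one_sub_inv_le_log_of_pos hx0
    have h5 : x⁻¹ - 1 ≤ 2 * (1 - x) := by
      have : x⁻¹ - 1 = (1 - x) * x⁻¹ := by field_simp
      rw [this, mul_comm]
      have h6 : x⁻¹ ≤ 2 := by
        rw [inv_le_comm₀ hx0 (by norm_num)]
        linarith [hx.1]
      exact mul_le_mul_of_nonneg_right h6 (by linarith [hx.2])
    linarith
  rw [norm_mul, Real.norm_eq_abs, Real.norm_eq_abs, Function.comp, abs_mul,
    abs_of_pos (show 0 < 1 - x by linarith [hx.2])]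
  calc |Real.log x| * |Real.log (1 - x) ^ k|
      ≤ (2 * (1 - x)) * |Real.log (1 - x) ^ k| := by gcongr
    _ = _ := by ring

theorem tendsto_log_nhdsLT_one : Tendsto Real.log (𝓝[<] 1) (𝓝 0) := by
  simpa using tendsto_log_mul_log_one_sub_pow 0

theorem tendsto_polylog_one_sub (s : ℕ) (ss : List ℕ) :
    Tendsto (fun x => polylog ((s + 1) :: ss) (1 - x)) (𝓝[<] 1) (𝓝 0) :=
  (tendsto_polylog_zero s ss).comp (tendsto_one_sub_nhdsLT.mono_right nhdsWithin_le_nhds)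

/-- The crude bound (n+1)^depth on the nested sum suffices for (2), (3), (4) and (3,1). It misses
(2,2) and (2,1,1), whose convergence comes from the stuffle identity and from `polylog_four_holder`.
-/
theorem summable_liCoeff {s : ℕ} {ss : List ℕ} (h : ss.length + 2 ≤ s) :
    Summable (liCoeff s ss) := by
  have h1 : Summable fun n : ℕ => 1 / ((n : ℝ) + 1) ^ 2 := by
    simpa using (summable_nat_add_iff 1).2
      (Real.summable_one_div_nat_pow.2 (by norm_num : 1 < 2))
  refine Summable.of_nonneg_of_le (liCoeff_nonneg s ss) (fun n => ?_) h1
  have hn : (1 : ℝ) ≤ (n : ℝ) + 1 := by simp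
  obtain ⟨d, rfl⟩ := Nat.exists_eq_add_of_le h
  rw [liCoeff, div_le_div_iff₀ (by positivity) (by positivity), one_mul, pow_add, pow_add]
  have h2 : nestedSum ss (n + 1) ≤ ((n : ℝ) + 1) ^ ss.length := by
    simpa using nestedSum_le ss (n + 1)
  calc nestedSum ss (n + 1) * ((n : ℝ) + 1) ^ 2
      ≤ ((n : ℝ) + 1) ^ ss.length * ((n : ℝ) + 1) ^ 2 := by gcongr
    _ ≤ _ := le_mul_of_one_le_right (by positivity) (one_le_pow₀ hn)

theorem polylog_two_one : polylog [2] 1 = Real.pi ^ 2 / 6 := by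
  have h := (hasSum_nat_add_iff' 1).2 hasSum_zeta_two
  refine HasSum.tsum_eq ?_
  simpa [liCoeff, nestedSum] using h

theorem polylog_four_one : polylog [4] 1 = Real.pi ^ 4 / 90 := by
  have h := (hasSum_nat_add_iff' 1).2 hasSum_zeta_four
  refine HasSum.tsum_eq ?_
  simpa [liCoeff, nestedSum] using h

theorem polylog_at_one (s : ℕ) (ss : List ℕ) : polylog (s :: ss) 1 = ∑' n, liCoeff s ss n := by
  simp [polylog]

section Derivatives

variable {x : ℝ}

theorem abs_lt_one_of_mem (hx : x ∈ Set.Ioo (0 : ℝ) 1) : |x| < 1 := by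
  rw [abs_of_pos hx.1]
  exact hx.2

theorem one_sub_mem (hx : x ∈ Set.Ioo (0 : ℝ) 1) : 1 - x ∈ Set.Ioo (0 : ℝ) 1 :=
  ⟨by linarith [hx.2], by linarith [hx.1]⟩

theorem hasDerivAt_polylog_of_mem (s : ℕ) (ss : List ℕ) (hx : x ∈ Set.Ioo (0 : ℝ) 1) :
    HasDerivAt (polylog ((s + 1) :: ss)) (polylog (s :: ss) x / x) x :=
  hasDerivAt_polylog s ss (abs_lt_one_of_mem hx) hx.1.ne'

theorem hasDerivAt_polylog_one_sub (s : ℕ) (ss : List ℕ) (hx : x ∈ Set.Ioo (0 : ℝ) 1) :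
    HasDerivAt (fun y => polylog ((s + 1) :: ss) (1 - y))
      (-(polylog (s :: ss) (1 - x) / (1 - x))) x := by
  simpa [Function.comp_def] using (hasDerivAt_polylog_of_mem s ss (one_sub_mem hx)).comp x
    ((hasDerivAt_id' x).const_sub 1)

theorem polylog_one_sub_one (hx : x ∈ Set.Ioo (0 : ℝ) 1) : polylog [1] (1 - x) = -Real.log x := by
  simpa using polylog_one (abs_lt_one_of_mem (one_sub_mem hx))

theorem polylog_one_one_one_sub (hx : x ∈ Set.Ioo (0 : ℝ) 1) :
    polylog [1, 1] (1 - x) = Real.log x ^ 2 / 2 := by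
  simpa using polylog_one_one (abs_lt_one_of_mem (one_sub_mem hx))

theorem polylog_one_one_one_one_sub (hx : x ∈ Set.Ioo (0 : ℝ) 1) :
    polylog [1, 1, 1] (1 - x) = -Real.log x ^ 3 / 6 := by
  simpa using polylog_one_one_one (abs_lt_one_of_mem (one_sub_mem hx))

end Derivatives

/-! ### Functions on (0,1) that are constant by path composition. -/

/-- Euler's reflection formula for the dilogarithm. -/
theorem polylog_two_reflection {x : ℝ} (hx : x ∈ Set.Ioo (0 : ℝ) 1) :
    polylog [2] x + polylog [2] (1 - x) + Real.log x * Real.log (1 - x) = polylog [2] 1 := by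
  refine eq_of_hasDerivAt_zero_of_tendsto
    (f := fun x => polylog [2] x + polylog [2] (1 - x) + Real.log x * Real.log (1 - x))
    eventually_mem_Ioo_nhdsLT_one (fun y hy => ?_) ?_ hx
  · have hy0 : y ≠ 0 := hy.1.ne'
    have hy1 : 1 - y ≠ 0 := (one_sub_mem hy).1.ne'
    have h := ((hasDerivAt_polylog_of_mem 1 [] hy).fun_add (hasDerivAt_polylog_one_sub 1 [] hy)).fun_add
      ((Real.hasDerivAt_log hy0).fun_mul
        (hasDerivAt_neg_log_one_sub (abs_lt_one_of_mem hy)).fun_neg)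
    simp only [neg_neg] at h
    convert! h using 1
    rw [polylog_one (abs_lt_one_of_mem hy), polylog_one_sub_one hy]
    field_simp
    ring
  · simpa using ((tendsto_polylog_one (summable_liCoeff (s := 2) (ss := []) (by simp))).add
      (tendsto_polylog_one_sub 1 [])).add (tendsto_log_mul_log_one_sub_pow 1)

/-- Path composition for the word of `ζ₄`. -/
theorem polylog_four_holder {x : ℝ} (hx : x ∈ Set.Ioo (0 : ℝ) 1) :
    polylog [4] x - Real.log x * polylog [3] x + Real.log x ^ 2 / 2 * polylog [2] x
      - Real.log x ^ 3 / 6 * polylog [1] x + polylog [2, 1, 1] (1 - x) = polylog [4] 1 := by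
  refine eq_of_hasDerivAt_zero_of_tendsto
    (f := fun x => polylog [4] x - Real.log x * polylog [3] x + Real.log x ^ 2 / 2 * polylog [2] x
      - Real.log x ^ 3 / 6 * polylog [1] x + polylog [2, 1, 1] (1 - x))
    eventually_mem_Ioo_nhdsLT_one (fun y hy => ?_) ?_ hx
  · have hy0 : y ≠ 0 := hy.1.ne'
    have hy1 : 1 - y ≠ 0 := (one_sub_mem hy).1.ne'
    have hl := Real.hasDerivAt_log hy0
    have h := ((((hasDerivAt_polylog_of_mem 3 [] hy).fun_sub
      (hl.fun_mul (hasDerivAt_polylog_of_mem 2 [] hy))).fun_add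
      (((hl.fun_pow 2).div_const 2).fun_mul (hasDerivAt_polylog_of_mem 1 [] hy))).fun_sub
      (((hl.fun_pow 3).div_const 6).fun_mul
        (hasDerivAt_polylog_one [] (abs_lt_one_of_mem hy)))).fun_add
      (hasDerivAt_polylog_one_sub 1 [1, 1] hy)
    convert! h using 1
    -- The product-rule terms telescope. What is left, -log³ y / (6(1-y)), cancels against the
    -- derivative of Li_{2,1,1}(1-y), since Li_{1,1,1}(1-y) = -log³ y / 6.
    rw [polylog_one_one_one_one_sub hy]
    simp only [polylog]
    field_simp
    norm_num
    ring
  · have hl := tendsto_log_nhdsLT_one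
    have h1 : Tendsto (fun x => Real.log x ^ 3 / 6 * polylog [1] x) (𝓝[<] 1) (𝓝 0) := by
      have h2 := (((hl.pow 2).mul (tendsto_log_mul_log_one_sub_pow 1)).div_const (-6))
      simp only [mul_zero, zero_div] at h2
      refine h2.congr' ?_
      filter_upwards [eventually_mem_Ioo_nhdsLT_one] with y hy
      rw [polylog_one (abs_lt_one_of_mem hy)]
      ring
    have h4 := tendsto_polylog_one (summable_liCoeff (s := 4) (ss := []) (by simp))
    have h3 := tendsto_polylog_one (summable_liCoeff (s := 3) (ss := []) (by simp))
    have h2 := tendsto_polylog_one (summable_liCoeff (s := 2) (ss := []) (by simp))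
    simpa using (((h4.sub (hl.mul h3)).add (((hl.pow 2).div_const 2).mul h2)).sub h1).add
      (tendsto_polylog_one_sub 1 [1, 1])

theorem polylog_le_neg_log (s : ℕ) {x : ℝ} (hx : x ∈ Set.Ioo (0 : ℝ) 1) :
    polylog [s + 1] x ≤ -Real.log (1 - x) := by
  rw [← polylog_one (abs_lt_one_of_mem hx)]
  induction s with
  | zero => exact le_rfl
  | succ s ih => exact (polylog_succ_le _ _ hx.1.le hx.2).trans ih

/-- In `polylog_four_holder` at 1-x every term besides Li_{2,1,1}(x) is nonnegative, because log
(1-x) ≤ 0. So ζ_4 bounds Li_{2,1,1} on (0,1), and the nonnegative coefficients are summable. -/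
theorem summable_liCoeff_two_one_one : Summable (liCoeff 2 [1, 1]) := by
  refine summable_of_tsum_mul_pow_le (C := polylog [4] 1) (liCoeff_nonneg 2 [1, 1])
    (fun x hx => summable_polylog _ _ (abs_lt_one_of_mem hx)) fun x hx => ?_
  change polylog [2, 1, 1] x ≤ _
  have hy := one_sub_mem hx
  have h := polylog_four_holder hy
  rw [sub_sub_cancel] at h
  have hl : 0 ≤ -Real.log (1 - x) := by
    have := Real.log_nonpos hy.1.le hy.2.le
    linarith
  have h4 := polylog_nonneg [4] hy.1.le
  have h3 := mul_nonneg hl (polylog_nonneg [3] hy.1.le)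
  have h2 := mul_nonneg (pow_nonneg hl 2) (polylog_nonneg [2] hy.1.le)
  have h1 := mul_nonneg (pow_nonneg hl 3) (polylog_nonneg [1] hy.1.le)
  linarith

/-- Duality: in `polylog_four_holder` at 1-x with x → 1, all products of logarithms and
polylogarithms vanish. -/
theorem polylog_two_one_one_at_one : polylog [2, 1, 1] 1 = polylog [4] 1 := by
  have h1 := tendsto_polylog_one summable_liCoeff_two_one_one
  refine tendsto_nhds_unique h1 ?_
  -- Each Li_{s+1}(1-x) is at most Li_1(1-x) = -log x, which reduces the limit to that of log x ·
  -- log^k (1-x).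
  have hb : ∀ k s : ℕ, Tendsto (fun x => Real.log (1 - x) ^ k * polylog [s + 1] (1 - x))
      (𝓝[<] 1) (𝓝 0) := by
    intro k s
    have hk := (tendsto_log_mul_log_one_sub_pow k).abs
    rw [abs_zero] at hk
    refine squeeze_zero_norm' ?_ hk
    filter_upwards [eventually_mem_Ioo_nhdsLT_one] with x hx
    have hy := one_sub_mem hx
    have h2 := polylog_le_neg_log s hy
    rw [sub_sub_cancel] at h2
    rw [norm_mul, Real.norm_of_nonneg (polylog_nonneg _ hy.1.le), Real.norm_eq_abs, mul_comm,
      abs_mul]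
    gcongr
    exact h2.trans (neg_le_abs _)
  have h := ((((hb 0 3).sub (hb 1 2)).add ((hb 2 1).div_const 2)).sub
    ((hb 3 0).div_const 6)).const_sub (polylog [4] 1)
  simp only [sub_zero, add_zero, zero_div] at h
  refine h.congr' ?_
  filter_upwards [eventually_mem_Ioo_nhdsLT_one] with x hx
  have h := polylog_four_holder (one_sub_mem hx)
  rw [sub_sub_cancel] at h
  simp only [zero_add, Nat.reduceAdd]
  linarith

/-- Path composition for the word of `ζ_{3,1}`. -/
theorem polylog_three_one_holder {x : ℝ} (hx : x ∈ Set.Ioo (0 : ℝ) 1) :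
    polylog [3, 1] x - Real.log x * polylog [2, 1] x + Real.log x ^ 2 / 2 * polylog [1, 1] x
      + polylog [2, 1] (1 - x) * polylog [1] x + polylog [3, 1] (1 - x) = polylog [3, 1] 1 := by
  refine eq_of_hasDerivAt_zero_of_tendsto
    (f := fun x => polylog [3, 1] x - Real.log x * polylog [2, 1] x
      + Real.log x ^ 2 / 2 * polylog [1, 1] x
      + polylog [2, 1] (1 - x) * polylog [1] x + polylog [3, 1] (1 - x))
    eventually_mem_Ioo_nhdsLT_one (fun y hy => ?_) ?_ hx
  · have hy0 : y ≠ 0 := hy.1.ne'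
    have hy1 : 1 - y ≠ 0 := (one_sub_mem hy).1.ne'
    have hl := Real.hasDerivAt_log hy0
    have h := ((((hasDerivAt_polylog_of_mem 2 [1] hy).fun_sub
      (hl.fun_mul (hasDerivAt_polylog_of_mem 1 [1] hy))).fun_add
      (((hl.fun_pow 2).div_const 2).fun_mul
        (hasDerivAt_polylog_one [1] (abs_lt_one_of_mem hy)))).fun_add
      ((hasDerivAt_polylog_one_sub 1 [1] hy).fun_mul
        (hasDerivAt_polylog_one [] (abs_lt_one_of_mem hy)))).fun_add
      (hasDerivAt_polylog_one_sub 2 [1] hy)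
    convert! h using 1
    -- After telescoping, the two terms with Li_1(y)/(1-y) cancel because Li_{1,1}(1-y) = log² y /
    -- 2.
    rw [polylog_one_one_one_sub hy]
    have e : polylog [] y = 1 := rfl
    rw [e]
    field_simp
    norm_num
    ring
  · have hl := tendsto_log_nhdsLT_one
    have h3 := tendsto_polylog_one (summable_liCoeff (s := 3) (ss := [1]) (by simp))
    -- Convergence of ζ_{2,1} is not needed: the bound Li_{2,1} ≤ Li_{1,1} = log² (1-x) / 2 is
    -- enough against log x.
    have h2 : Tendsto (fun x => Real.log x * polylog [2, 1] x) (𝓝[<] 1) (𝓝 0) := by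
      have hk := (tendsto_log_mul_log_one_sub_pow 2).abs
      rw [abs_zero] at hk
      refine squeeze_zero_norm' ?_ hk
      filter_upwards [eventually_mem_Ioo_nhdsLT_one] with y hy
      rw [norm_mul, Real.norm_of_nonneg (polylog_nonneg _ hy.1.le), Real.norm_eq_abs, abs_mul]
      gcongr
      refine (polylog_succ_le 1 [1] hy.1.le hy.2).trans ?_
      rw [polylog_one_one (abs_lt_one_of_mem hy)]
      exact (half_le_self (sq_nonneg _)).trans (le_abs_self _)
    have h1 : Tendsto (fun x => Real.log x ^ 2 / 2 * polylog [1, 1] x) (𝓝[<] 1) (𝓝 0) := by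
      have := ((tendsto_log_mul_log_one_sub_pow 1).pow 2).div_const 4
      simp only [ne_eq, OfNat.ofNat_ne_zero, not_false_eq_true, zero_pow, zero_div] at this
      refine this.congr' ?_
      filter_upwards [eventually_mem_Ioo_nhdsLT_one] with y hy
      rw [polylog_one_one (abs_lt_one_of_mem hy)]
      ring
    have h0 : Tendsto (fun x => polylog [2, 1] (1 - x) * polylog [1] x) (𝓝[<] 1) (𝓝 0) := by
      have := (hl.mul (tendsto_log_mul_log_one_sub_pow 1)).abs
      simp only [mul_zero, abs_zero] at this
      refine squeeze_zero_norm' ?_ this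
      filter_upwards [eventually_mem_Ioo_nhdsLT_one] with y hy
      have hy' := one_sub_mem hy
      rw [norm_mul, Real.norm_of_nonneg (polylog_nonneg _ hy'.1.le),
        polylog_one (abs_lt_one_of_mem hy), norm_neg, Real.norm_eq_abs, ← mul_assoc, pow_one,
        abs_mul, ← pow_two]
      gcongr
      refine (polylog_succ_le 1 [1] hy'.1.le hy'.2).trans ?_
      rw [polylog_one_one_one_sub hy]
      exact (half_le_self (sq_nonneg _)).trans (le_abs_self _)
    simpa using (((h3.sub h2).add h1).add h0).add (tendsto_polylog_one_sub 2 [1])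

/-! ### Double shuffle relations in weight four. -/

/-- The stuffle product `ζ₂² = 2 ζ_{2,2} + ζ₄`. -/
theorem hasSum_liCoeff_two_two :
    HasSum (liCoeff 2 [2]) ((polylog [2] 1 ^ 2 - polylog [4] 1) / 2) := by
  rw [hasSum_iff_tendsto_nat_of_nonneg (liCoeff_nonneg 2 [2])]
  have h2 := (summable_liCoeff (s := 2) (ss := []) (by simp)).hasSum.tendsto_sum_nat
  have h4 := (summable_liCoeff (s := 4) (ss := []) (by simp)).hasSum.tendsto_sum_nat
  rw [← polylog_at_one] at h2 h4
  refine (((h2.pow 2).sub h4).div_const 2).congr fun N => ?_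
  rw [eq_comm, eq_div_iff two_ne_zero, eq_sub_iff_add_eq]
  have hS : ∀ n, nestedSum [2] (n + 1) = ∑ m ∈ Finset.range n, liCoeff 2 [] m := by
    intro n
    rw [nestedSum, Finset.sum_Ico_eq_sum_range]
    refine Finset.sum_congr (by simp) fun m _ => ?_
    rw [liCoeff, nestedSum, nestedSum]
    push_cast
    ring
  -- For partial sums S and a new term a, (S + a)² = S² + 2Sa + a²: here Sa is the new term of
  -- ζ_{2,2} and a² that of ζ_4.
  induction N with
  | zero => simp
  | succ N ih =>
    rw [Finset.sum_range_succ, Finset.sum_range_succ, Finset.sum_range_succ, add_sq, ← ih]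
    have h : liCoeff 2 [2] N = (∑ m ∈ Finset.range N, liCoeff 2 [] m) * liCoeff 2 [] N := by
      rw [liCoeff, hS, liCoeff, nestedSum]
      ring
    have h' : liCoeff 4 [] N = liCoeff 2 [] N ^ 2 := by
      rw [liCoeff, liCoeff, nestedSum, div_pow, one_pow, ← pow_mul]
    rw [h, h']
    ring

theorem polylog_two_two_at_one :
    polylog [2, 2] 1 = (polylog [2] 1 ^ 2 - polylog [4] 1) / 2 := by
  rw [polylog_at_one]
  exact hasSum_liCoeff_two_two.tsum_eq

theorem eventually_mem_Ioo_nhdsGT_zero : ∀ᶠ x : ℝ in 𝓝[>] 0, x ∈ Set.Ioo (0 : ℝ) 1 :=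
  Ioo_mem_nhdsGT (zero_lt_one' ℝ)

/-- A shuffle product, proved by differentiating and comparing at 0. It is what the derivative of
Li_2² requires in `polylog_two_sq`. -/
theorem polylog_one_mul_polylog_two {x : ℝ} (hx : x ∈ Set.Ioo (0 : ℝ) 1) :
    polylog [1] x * polylog [2] x = polylog [1, 2] x + 2 * polylog [2, 1] x := by
  refine sub_eq_zero.1 (eq_of_hasDerivAt_zero_of_tendsto
    (f := fun x => polylog [1] x * polylog [2] x - (polylog [1, 2] x + 2 * polylog [2, 1] x))
    eventually_mem_Ioo_nhdsGT_zero (fun y hy => ?_) ?_ hx)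
  · have ha := abs_lt_one_of_mem hy
    have hy0 : y ≠ 0 := hy.1.ne'
    have hy1 : 1 - y ≠ 0 := (one_sub_mem hy).1.ne'
    have h := ((hasDerivAt_polylog_one [] ha).fun_mul (hasDerivAt_polylog_of_mem 1 [] hy)).fun_sub
      ((hasDerivAt_polylog_one [2] ha).fun_add
        ((hasDerivAt_polylog_of_mem 1 [1] hy).const_mul 2))
    convert! h using 1
    rw [polylog_one_one ha, polylog_one ha]
    have e : polylog [] y = 1 := rfl
    rw [e]
    field_simp
    ring
  · refine Tendsto.mono_left ?_ nhdsWithin_le_nhds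
    simpa using ((tendsto_polylog_zero 0 []).mul (tendsto_polylog_zero 1 [])).sub
      ((tendsto_polylog_zero 0 [2]).add ((tendsto_polylog_zero 1 [1]).const_mul 2))

theorem polylog_two_sq {x : ℝ} (hx : x ∈ Set.Ioo (0 : ℝ) 1) :
    polylog [2] x ^ 2 = 2 * polylog [2, 2] x + 4 * polylog [3, 1] x := by
  refine sub_eq_zero.1 (eq_of_hasDerivAt_zero_of_tendsto
    (f := fun x => polylog [2] x ^ 2 - (2 * polylog [2, 2] x + 4 * polylog [3, 1] x))
    eventually_mem_Ioo_nhdsGT_zero (fun y hy => ?_) ?_ hx)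
  · have hy0 : y ≠ 0 := hy.1.ne'
    have h := ((hasDerivAt_polylog_of_mem 1 [] hy).fun_pow 2).fun_sub
      (((hasDerivAt_polylog_of_mem 1 [2] hy).const_mul 2).fun_add
        ((hasDerivAt_polylog_of_mem 2 [1] hy).const_mul 4))
    convert! h using 1
    have := polylog_one_mul_polylog_two hy
    field_simp
    norm_num
    linarith
  · refine Tendsto.mono_left ?_ nhdsWithin_le_nhds
    simpa using ((tendsto_polylog_zero 1 []).pow 2).sub
      (((tendsto_polylog_zero 1 [2]).const_mul 2).add ((tendsto_polylog_zero 2 [1]).const_mul 4))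

/-- The shuffle product `ζ₂² = 2 ζ_{2,2} + 4 ζ_{3,1}`. -/
theorem polylog_two_sq_at_one :
    polylog [2] 1 ^ 2 = 2 * polylog [2, 2] 1 + 4 * polylog [3, 1] 1 := by
  have h2 := tendsto_polylog_one (summable_liCoeff (s := 2) (ss := []) (by simp))
  have h22 := tendsto_polylog_one hasSum_liCoeff_two_two.summable
  have h31 := tendsto_polylog_one (summable_liCoeff (s := 3) (ss := [1]) (by simp))
  refine tendsto_nhds_unique ((h2.pow 2).congr' ?_) ((h22.const_mul 2).add (h31.const_mul 4))
  filter_upwards [eventually_mem_Ioo_nhdsLT_one] with y hy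
  exact polylog_two_sq hy

/-- Subtracting the stuffle from the shuffle expansion of ζ_2² eliminates ζ_{2,2}. -/
theorem polylog_three_one_at_one : polylog [3, 1] 1 = polylog [4] 1 / 4 := by
  have h1 := polylog_two_sq_at_one
  have h2 := polylog_two_two_at_one
  linarith

theorem polylog_two_sq_eq : polylog [2] 1 ^ 2 = 5 / 2 * polylog [4] 1 := by
  rw [polylog_two_one, polylog_four_one]
  ring

/-! ### Specialization at x = 1/2: delta values. -/

theorem log_half : Real.log (1 / 2) = -Real.log 2 := by
  rw [one_div, Real.log_inv]

theorem polylog_two_at_one_eq_delta :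
    polylog [2] 1 = 2 * delta [2] + Real.log 2 ^ 2 := by
  have h := polylog_two_reflection (x := 1 / 2) (by norm_num)
  have e : (1 : ℝ) - 1 / 2 = 1 / 2 := by norm_num
  rw [e, log_half] at h
  rw [delta_cons, ← h]
  ring

theorem polylog_one_half : polylog [1] (1 / 2) = Real.log 2 := by
  rw [polylog_one (by norm_num [abs_of_pos])]
  norm_num [log_half]

theorem polylog_one_one_half : polylog [1, 1] (1 / 2) = Real.log 2 ^ 2 / 2 := by
  rw [polylog_one_one (by norm_num [abs_of_pos])]
  norm_num [log_half]

/-- Hölder convolution for `ζ₄`. -/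
theorem polylog_four_at_one_eq_delta :
    polylog [4] 1 = delta [2, 1, 1] + (1 / 6) * Real.log 2 ^ 4
      + (1 / 2) * delta [2] * Real.log 2 ^ 2 + delta [3] * Real.log 2 + delta [4] := by
  have h := polylog_four_holder (x := 1 / 2) (by norm_num)
  have e : (1 : ℝ) - 1 / 2 = 1 / 2 := by norm_num
  rw [e, log_half, polylog_one_half] at h
  rw [delta_cons, delta_cons, delta_cons, delta_cons, ← h]
  ring

/-- The word of ζ_{3,1} is self-dual, so at the midpoint x = 1-x = 1/2 the two halves of the path
contribute equally; hence the factors 2. -/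
theorem polylog_three_one_at_one_eq_delta :
    polylog [3, 1] 1 = 2 * delta [3, 1] + 2 * delta [2, 1] * Real.log 2
      + (1 / 4) * Real.log 2 ^ 4 := by
  have h := polylog_three_one_holder (x := 1 / 2) (by norm_num)
  have e : (1 : ℝ) - 1 / 2 = 1 / 2 := by norm_num
  rw [e, log_half, polylog_one_half, polylog_one_one_half] at h
  rw [delta_cons, delta_cons, ← h]
  ring

/-! ### Iterated integrals -/

section IteratedIntegral

variable {α : Type*}

/-- The list of all shuffles of two words. -/
def shuffles : List α → List α → List (List α)
  | [], v => [v]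
  | a :: u, [] => [a :: u]
  | a :: u, b :: v => (shuffles u (b :: v)).map (a :: ·) ++ (shuffles (a :: u) v).map (b :: ·)
  termination_by u v => u.length + v.length

variable {φ : α → ℝ → ℝ}

theorem continuous_iteratedIntegral (hφ : ∀ a, Continuous (φ a)) (w : List α) :
    Continuous (iteratedIntegral (w.map φ) 0) := by
  induction w with
  | nil => exact continuous_const
  | cons a w ih =>
    exact intervalIntegral.continuous_primitive
      (fun x y => ((hφ a).mul ih).intervalIntegrable x y) 0

theorem hasDerivAt_iteratedIntegral (hφ : ∀ a, Continuous (φ a)) (a : α) (w : List α) (T : ℝ) :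
    HasDerivAt (iteratedIntegral ((a :: w).map φ) 0)
      (φ a T * iteratedIntegral (w.map φ) 0 T) T :=
  ((hφ a).mul (continuous_iteratedIntegral hφ w)).integral_hasStrictDerivAt 0 T |>.hasDerivAt

theorem iteratedIntegral_cons_self (a : α) (w : List α) (x : ℝ) :
    iteratedIntegral ((a :: w).map φ) x x = 0 := by
  simp [iteratedIntegral]

theorem hasDerivAt_sum_iteratedIntegral_cons (hφ : ∀ a, Continuous (φ a)) (a : α)
    (W : List (List α)) (T : ℝ) :
    HasDerivAt (fun T => ((W.map (a :: ·)).map fun w => iteratedIntegral (w.map φ) 0 T).sum)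
      (φ a T * (W.map fun w => iteratedIntegral (w.map φ) 0 T).sum) T := by
  induction W with
  | nil => simpa using hasDerivAt_const T (0 : ℝ)
  | cons w W ih =>
    simp only [List.map_cons, List.sum_cons, mul_add] at ih ⊢
    exact (hasDerivAt_iteratedIntegral hφ a w T).add ih

theorem sum_iteratedIntegral_cons_self (a : α) (W : List (List α)) (x : ℝ) :
    ((W.map (a :: ·)).map fun w => iteratedIntegral (w.map φ) x x).sum = 0 := by
  induction W with
  | nil => simp
  | cons w W ih =>
    rw [List.map_cons, List.map_cons, List.sum_cons, ih, iteratedIntegral_cons_self, add_zero]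

/-- The shuffle product formula for iterated integrals. -/
theorem iteratedIntegral_mul (hφ : ∀ a, Continuous (φ a)) (u v : List α) (T : ℝ) :
    iteratedIntegral (u.map φ) 0 T * iteratedIntegral (v.map φ) 0 T =
      ((shuffles u v).map fun w => iteratedIntegral (w.map φ) 0 T).sum := by
  induction u, v using shuffles.induct generalizing T with
  | case1 v => simp [shuffles, iteratedIntegral]
  | case2 a u => simp [shuffles, iteratedIntegral]
  | case3 a u b v ih1 ih2 =>
    -- By the Leibniz rule, differentiation strips the first letter of either word, and the
    -- induction hypotheses match the two halves of the shuffle. Both sides vanish at 0.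
    have hd : ∀ S, HasDerivAt (fun S => iteratedIntegral ((a :: u).map φ) 0 S *
        iteratedIntegral ((b :: v).map φ) 0 S -
          ((shuffles (a :: u) (b :: v)).map fun w => iteratedIntegral (w.map φ) 0 S).sum) 0 S := by
      intro S
      have h := ((hasDerivAt_iteratedIntegral hφ a u S).fun_mul
        (hasDerivAt_iteratedIntegral hφ b v S)).fun_sub
        ((hasDerivAt_sum_iteratedIntegral_cons hφ a (shuffles u (b :: v)) S).fun_add
          (hasDerivAt_sum_iteratedIntegral_cons hφ b (shuffles (a :: u) v) S))
      rw [← ih1, ← ih2] at h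
      simp only [shuffles, List.map_append, List.sum_append]
      convert! h using 1
      ring
    have h := is_const_of_deriv_eq_zero (fun S => (hd S).differentiableAt)
      (fun S => (hd S).deriv) T 0
    rw [iteratedIntegral_cons_self, zero_mul, shuffles, List.map_append, List.sum_append,
      List.map_append, List.sum_append, sum_iteratedIntegral_cons_self,
      sum_iteratedIntegral_cons_self, add_zero, sub_zero] at h
    rw [shuffles, List.map_append, List.sum_append]
    linarith

theorem iteratedIntegral_nonneg (h0 : ∀ a t, 0 ≤ t → 0 ≤ φ a t) (w : List α) {T : ℝ}
    (hT : 0 ≤ T) : 0 ≤ iteratedIntegral (w.map φ) 0 T := by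
  induction w generalizing T with
  | nil => exact zero_le_one
  | cons a w ih =>
    exact intervalIntegral.integral_nonneg hT fun t ht => mul_nonneg (h0 a t ht.1) (ih ht.1)

/-- A uniform bound on the inner integral makes the outermost integrand integrable on the half-line,
so that iterated integrals converge as T → ∞. -/
theorem exists_iteratedIntegral_le (hφ : ∀ a, Continuous (φ a))
    (h0 : ∀ a t, 0 ≤ t → 0 ≤ φ a t) (hi : ∀ a, IntegrableOn (φ a) (Set.Ioi 0)) (w : List α) :
    ∃ C, ∀ T, 0 ≤ T → iteratedIntegral (w.map φ) 0 T ≤ C := by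
  induction w with
  | nil => exact ⟨1, fun T _ => le_rfl⟩
  | cons a w ih =>
    obtain ⟨C, hC⟩ := ih
    have hC0 : 0 ≤ C := (iteratedIntegral_nonneg h0 w le_rfl).trans (hC 0 le_rfl)
    refine ⟨(∫ t in Set.Ioi 0, φ a t) * C, fun T hT => ?_⟩
    calc iteratedIntegral ((a :: w).map φ) 0 T
        ≤ ∫ t in (0 : ℝ)..T, φ a t * C := by
          refine intervalIntegral.integral_mono_on hT
            (((hφ a).mul (continuous_iteratedIntegral hφ w)).intervalIntegrable _ _)
            (((hφ a).mul continuous_const).intervalIntegrable _ _) fun t ht => ?_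
          exact mul_le_mul_of_nonneg_left (hC t ht.1) (h0 a t ht.1)
      _ = (∫ t in (0 : ℝ)..T, φ a t) * C := intervalIntegral.integral_mul_const _ _
      _ ≤ _ := by
          refine mul_le_mul_of_nonneg_right ?_ hC0
          rw [intervalIntegral.integral_of_le hT]
          refine setIntegral_mono_set (hi a) ?_ Set.Ioc_subset_Ioi_self.eventuallyLE
          filter_upwards [ae_restrict_mem measurableSet_Ioi] with t ht
          exact h0 a t (le_of_lt ht)

theorem tendsto_iteratedIntegral (hφ : ∀ a, Continuous (φ a))
    (h0 : ∀ a t, 0 ≤ t → 0 ≤ φ a t) (hi : ∀ a, IntegrableOn (φ a) (Set.Ioi 0)) (w : List α) :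
    Tendsto (iteratedIntegral (w.map φ) 0) atTop (𝓝 (iteratedIntegralTop (w.map φ) 0)) := by
  cases w with
  | nil => exact tendsto_const_nhds
  | cons a w =>
    obtain ⟨C, hC⟩ := exists_iteratedIntegral_le hφ h0 hi w
    refine intervalIntegral_tendsto_integral_Ioi 0 ?_ tendsto_id
    refine Integrable.mul_bdd (c := C) (hi a)
      (continuous_iteratedIntegral hφ w).aestronglyMeasurable ?_
    filter_upwards [ae_restrict_mem measurableSet_Ioi] with t ht
    rw [Real.norm_of_nonneg (iteratedIntegral_nonneg h0 w (le_of_lt ht))]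
    exact hC t (le_of_lt ht)

theorem iteratedIntegralTop_mul (hφ : ∀ a, Continuous (φ a))
    (h0 : ∀ a t, 0 ≤ t → 0 ≤ φ a t) (hi : ∀ a, IntegrableOn (φ a) (Set.Ioi 0)) (u v : List α) :
    iteratedIntegralTop (u.map φ) 0 * iteratedIntegralTop (v.map φ) 0 =
      ((shuffles u v).map fun w => iteratedIntegralTop (w.map φ) 0).sum := by
  have h1 := (tendsto_iteratedIntegral hφ h0 hi u).mul (tendsto_iteratedIntegral hφ h0 hi v)
  simp only [iteratedIntegral_mul hφ] at h1
  exact tendsto_nhds_unique h1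
    (tendsto_list_sum _ fun w _ => tendsto_iteratedIntegral hφ h0 hi w)

theorem iteratedIntegral_congr {ψ : α → ℝ → ℝ} (h : ∀ a t, 0 ≤ t → φ a t = ψ a t) (w : List α)
    {T : ℝ} (hT : 0 ≤ T) :
    iteratedIntegral (w.map φ) 0 T = iteratedIntegral (w.map ψ) 0 T := by
  induction w generalizing T with
  | nil => rfl
  | cons a w ih =>
    refine intervalIntegral.integral_congr fun t ht => ?_
    rw [Set.uIcc_of_le hT] at ht
    simp only [h a t ht.1, ih ht.1]

theorem iteratedIntegralTop_congr {ψ : α → ℝ → ℝ} (h : ∀ a t, 0 ≤ t → φ a t = ψ a t)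
    (w : List α) : iteratedIntegralTop (w.map φ) 0 = iteratedIntegralTop (w.map ψ) 0 := by
  cases w with
  | nil => rfl
  | cons a w =>
    refine setIntegral_congr_fun measurableSet_Ioi fun t ht => ?_
    simp only [h a t (le_of_lt ht), iteratedIntegral_congr h w (le_of_lt ht)]

end IteratedIntegral

/-! ### Evaluation of the integrals `I_{ℓ₁ … ℓ_r}` -/

theorem integrableOn_pow_mul_exp_neg_mul (m : ℕ) {b : ℝ} (hb : 0 < b) :
    IntegrableOn (fun t : ℝ => t ^ m * Real.exp (-(b * t))) (Set.Ioi 0) := by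
  have hm : (-1 : ℝ) < m := by linarith [(Nat.cast_nonneg m : (0 : ℝ) ≤ m)]
  simpa using integrableOn_rpow_mul_exp_neg_mul_rpow hm one_pos hb

theorem integral_pow_mul_exp_neg_mul (m : ℕ) {b : ℝ} (hb : 0 < b) :
    ∫ t in Set.Ioi (0 : ℝ), t ^ m * Real.exp (-(b * t)) = m.factorial / b ^ (m + 1) := by
  have h := Real.integral_rpow_mul_exp_neg_mul_Ioi (a := m + 1) (by positivity) hb
  rw [Real.Gamma_nat_eq_factorial] at h
  have e : ((m : ℝ) + 1) = ((m + 1 : ℕ) : ℝ) := by push_cast; rfl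
  simp only [add_sub_cancel_right, Real.rpow_natCast] at h
  rw [h, e, Real.rpow_natCast, one_div, inv_pow]
  ring

theorem one_le_two_mul_exp_sub_one {t : ℝ} (ht : 0 ≤ t) :
    Real.exp t ≤ 2 * Real.exp t - 1 := by
  linarith [Real.one_le_exp ht]

theorem exp_neg_div_two_mem {t : ℝ} (ht : 0 ≤ t) :
    Real.exp (-t) / 2 ∈ Set.Ioc (0 : ℝ) (1 / 2) := by
  refine ⟨by positivity, ?_⟩
  have : Real.exp (-t) ≤ 1 := Real.exp_le_one_iff.2 (by linarith)
  linarith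

theorem abs_exp_neg_div_two_lt_one {t : ℝ} (ht : 0 ≤ t) : |Real.exp (-t) / 2| < 1 := by
  have h := exp_neg_div_two_mem ht
  rw [abs_of_pos h.1]
  linarith [h.2]

theorem exp_neg_div_two_div (t : ℝ) (ht : 0 ≤ t) :
    Real.exp (-t) / 2 / (1 - Real.exp (-t) / 2) = 1 / (2 * Real.exp t - 1) := by
  have h1 := one_le_two_mul_exp_sub_one ht
  have h2 := Real.exp_pos t
  have h3 : 2 * Real.exp t - 1 ≠ 0 := by linarith
  rw [Real.exp_neg, div_eq_div_iff _ h3]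
  · field_simp
  · have e : 1 - (Real.exp t)⁻¹ / 2 = (2 * Real.exp t - 1) / (2 * Real.exp t) := by field_simp
    rw [e]
    positivity

/-- With x = e^{-t}/2 the weight 1/(2e^t-1) is x/(1-x), so the integrand is t^m times a power series
in x whose coefficients are nested sums. The Gamma integral of t^m e^{-(n+1)t} is m!/(n+1)^{m+1},
which supplies the new leading index m+1. -/
theorem integral_pow_div_mul_polylog (m : ℕ) (ss : List ℕ) :
    ∫ t in Set.Ioi (0 : ℝ), t ^ m / (2 * Real.exp t - 1) * polylog ss (Real.exp (-t) / 2) =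
      m.factorial * polylog ((m + 1) :: ss) (1 / 2) := by
  let F : ℕ → ℝ → ℝ := fun n t =>
    nestedSum ss (n + 1) * (1 / 2) ^ (n + 1) * (t ^ m * Real.exp (-(((n : ℝ) + 1) * t)))
  have hint : ∀ n, IntegrableOn (F n) (Set.Ioi 0) := fun n =>
    (integrableOn_pow_mul_exp_neg_mul m (by positivity)).const_mul _
  have hval : ∀ n, ∫ t in Set.Ioi (0 : ℝ), F n t =
      m.factorial * (liCoeff (m + 1) ss n * (1 / 2) ^ (n + 1)) := fun n => by
    simp only [F]
    rw [integral_const_mul, integral_pow_mul_exp_neg_mul m (by positivity), liCoeff]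
    ring
  have hnorm : ∀ n, ∫ t in Set.Ioi (0 : ℝ), ‖F n t‖ =
      m.factorial * (liCoeff (m + 1) ss n * (1 / 2) ^ (n + 1)) := fun n => by
    rw [← hval]
    refine setIntegral_congr_fun measurableSet_Ioi fun t ht => Real.norm_of_nonneg ?_
    have ht' : (0 : ℝ) < t := ht
    have := nestedSum_nonneg ss (n + 1)
    positivity
  have hs := (summable_polylog (m + 1) ss (x := 1 / 2) (by norm_num [abs_of_pos])).mul_left
    (m.factorial : ℝ)
  have key := hasSum_integral_of_summable_integral_norm hint (by simpa only [hnorm] using hs)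
  have hF : ∫ t in Set.Ioi (0 : ℝ), ∑' n, F n t = ∫ t in Set.Ioi (0 : ℝ),
      t ^ m / (2 * Real.exp t - 1) * polylog ss (Real.exp (-t) / 2) := by
    refine setIntegral_congr_fun measurableSet_Ioi fun t ht => ?_
    have ht' : (0 : ℝ) ≤ t := le_of_lt ht
    have h := (tsum_nestedSum_mul_pow ss (abs_exp_neg_div_two_lt_one ht')).mul_left
      (t ^ m * (Real.exp (-t) / 2))
    have e : t ^ m / (2 * Real.exp t - 1) * polylog ss (Real.exp (-t) / 2) =
        t ^ m * (Real.exp (-t) / 2) *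
          (polylog ss (Real.exp (-t) / 2) / (1 - Real.exp (-t) / 2)) := by
      rw [div_eq_mul_one_div (t ^ m), ← exp_neg_div_two_div t ht']
      ring
    rw [e, ← h.tsum_eq]
    refine tsum_congr fun n => ?_
    have he : Real.exp (-(((n : ℝ) + 1) * t)) = Real.exp (-t) ^ (n + 1) := by
      rw [← Real.exp_nat_mul]
      push_cast
      ring_nf
    simp only [F, he]
    ring
  rw [← hF, ← key.tsum_eq]
  simp only [hval]
  rw [tsum_mul_left]
  rfl

/-- The form t^m/(2e^t-1) has its denominator vanish at t = -ln 2, while the shuffle formula assumes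
continuity on all of ℝ. Replacing t by |t| in the exponential changes nothing on [0, ∞). -/
theorem continuous_pow_div_exp_abs (m : ℕ) :
    Continuous fun t : ℝ => t ^ m / (2 * Real.exp |t| - 1) := by
  refine Continuous.div (by fun_prop) (by fun_prop) fun t => ?_
  have := one_le_two_mul_exp_sub_one (abs_nonneg t)
  linarith [Real.exp_pos |t|]

theorem pow_div_exp_abs_nonneg (m : ℕ) (t : ℝ) (ht : 0 ≤ t) :
    0 ≤ t ^ m / (2 * Real.exp |t| - 1) := by
  have := one_le_two_mul_exp_sub_one (abs_nonneg t)
  have h2 := Real.exp_pos |t|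
  exact div_nonneg (by positivity) (by linarith)

theorem integrableOn_pow_div_exp_abs (m : ℕ) :
    IntegrableOn (fun t : ℝ => t ^ m / (2 * Real.exp |t| - 1)) (Set.Ioi 0) := by
  refine Integrable.mono' (integrableOn_pow_mul_exp_neg_mul m one_pos)
    (continuous_pow_div_exp_abs m).aestronglyMeasurable ?_
  filter_upwards [ae_restrict_mem measurableSet_Ioi] with t ht
  have ht' : (0 : ℝ) < t := ht
  rw [Real.norm_of_nonneg (pow_div_exp_abs_nonneg m t ht'.le), abs_of_pos ht', one_mul,
    Real.exp_neg, ← div_eq_mul_inv]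
  have := one_le_two_mul_exp_sub_one ht'.le
  gcongr

/-- The integral `ℓ₁! ⋯ ℓ_r! I_{ℓ₁ … ℓ_r}`. -/
noncomputable def expIntegral (l : List ℕ) : ℝ :=
  iteratedIntegralTop (l.map fun m t => t ^ m / (2 * Real.exp t - 1)) 0

theorem pow_div_exp_eq_abs (m : ℕ) (t : ℝ) (ht : 0 ≤ t) :
    t ^ m / (2 * Real.exp t - 1) = t ^ m / (2 * Real.exp |t| - 1) := by
  rw [abs_of_nonneg ht]

theorem expIntegral_eq_abs (l : List ℕ) : expIntegral l =
    iteratedIntegralTop (l.map fun m t => t ^ m / (2 * Real.exp |t| - 1)) 0 :=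
  iteratedIntegralTop_congr pow_div_exp_eq_abs l

theorem expIntegral_mul (u v : List ℕ) :
    expIntegral u * expIntegral v = ((shuffles u v).map expIntegral).sum := by
  simp only [funext expIntegral_eq_abs]
  exact iteratedIntegralTop_mul continuous_pow_div_exp_abs pow_div_exp_abs_nonneg
    integrableOn_pow_div_exp_abs u v

theorem expIntegral_singleton (m : ℕ) :
    expIntegral [m] = m.factorial * delta [m + 1] := by
  rw [delta_cons, ← integral_pow_div_mul_polylog]
  rfl

theorem expIntegral_zero : expIntegral [0] = Real.log 2 := by
  rw [expIntegral_singleton, delta_cons, polylog_one_half]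
  simp

/-- An antiderivative of 1/(2e^t-1) is -Li_1(e^{-t}/2), and Li_1(1/2) = ln 2. -/
theorem iteratedIntegral_zero {T : ℝ} (hT : 0 ≤ T) :
    iteratedIntegral ([0].map fun m t => t ^ m / (2 * Real.exp t - 1)) 0 T =
      Real.log 2 - polylog [1] (Real.exp (-T) / 2) := by
  have hd : ∀ t ∈ Set.uIcc 0 T, HasDerivAt (fun t => -polylog [1] (Real.exp (-t) / 2))
      (t ^ 0 / (2 * Real.exp t - 1) * 1) t := by
    intro t ht
    rw [Set.uIcc_of_le hT] at ht
    have h1 : HasDerivAt (fun t : ℝ => Real.exp (-t) / 2) (-(Real.exp (-t) / 2)) t := by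
      simpa [neg_div] using ((hasDerivAt_id' t).fun_neg.exp).div_const 2
    have h := ((hasDerivAt_polylog_one [] (abs_exp_neg_div_two_lt_one ht.1)).comp t h1).fun_neg
    simp only [Function.comp_def] at h
    convert! h using 1
    rw [pow_zero, mul_one, ← exp_neg_div_two_div t ht.1, polylog]
    ring
  have hc : IntervalIntegrable (fun t : ℝ => t ^ 0 / (2 * Real.exp t - 1) * 1) volume 0 T := by
    refine ContinuousOn.intervalIntegrable ?_
    refine ContinuousOn.mul (ContinuousOn.div (by fun_prop) (by fun_prop) fun t ht => ?_)
      continuousOn_const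
    rw [Set.uIcc_of_le hT] at ht
    have := one_le_two_mul_exp_sub_one ht.1
    linarith [Real.exp_pos t]
  refine (intervalIntegral.integral_eq_sub_of_hasDerivAt hd hc).trans ?_
  rw [neg_zero, Real.exp_zero, polylog_one_half]
  ring

theorem iteratedIntegral_zero_zero {T : ℝ} (hT : 0 ≤ T) :
    iteratedIntegral ([0, 0].map fun m t => t ^ m / (2 * Real.exp t - 1)) 0 T =
      (Real.log 2 - polylog [1] (Real.exp (-T) / 2)) ^ 2 / 2 := by
  rw [← iteratedIntegral_zero hT, iteratedIntegral_congr pow_div_exp_eq_abs _ hT,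
    iteratedIntegral_congr pow_div_exp_eq_abs _ hT]
  have h := iteratedIntegral_mul continuous_pow_div_exp_abs [0] [0] T
  simp only [shuffles, List.map_cons, List.map_nil, List.cons_append, List.nil_append,
    List.sum_cons, List.sum_nil] at h ⊢
  linarith

theorem integrableOn_pow_div_mul_polylog (m : ℕ) {ss : List ℕ}
    (hc : ContinuousOn (polylog ss) (Set.Icc 0 (1 / 2))) :
    IntegrableOn (fun t : ℝ => t ^ m / (2 * Real.exp t - 1) * polylog ss (Real.exp (-t) / 2))
      (Set.Ioi 0) := by
  obtain ⟨C, hC⟩ := isCompact_Icc.exists_bound_of_continuousOn hc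
  have hm : ∀ t ∈ Set.Ioi (0 : ℝ), Real.exp (-t) / 2 ∈ Set.Icc (0 : ℝ) (1 / 2) := fun t ht =>
    Set.Ioc_subset_Icc_self (exp_neg_div_two_mem (le_of_lt ht))
  refine Integrable.mul_bdd (c := C) ((integrableOn_pow_div_exp_abs m).congr_fun
    (fun t ht => (pow_div_exp_eq_abs m t (le_of_lt ht)).symm) measurableSet_Ioi) ?_ ?_
  · exact (hc.comp (by fun_prop) hm).aestronglyMeasurable measurableSet_Ioi
  · filter_upwards [ae_restrict_mem measurableSet_Ioi] with t ht
    exact hC _ (hm t ht)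

theorem continuousOn_polylog_half (ss : List ℕ) :
    ContinuousOn (polylog ((1 : ℕ) :: ss)) (Set.Icc 0 (1 / 2)) := fun x hx =>
  (hasDerivAt_polylog_one ss (by rw [abs_of_nonneg hx.1]; linarith [hx.2])
    ).continuousAt.continuousWithinAt

theorem expIntegral_pair_zero (m : ℕ) :
    expIntegral [m, 0] = m.factorial * (Real.log 2 * delta [m + 1] - delta [m + 1, 1]) := by
  have h0 := integral_pow_div_mul_polylog m []
  have h1 := integral_pow_div_mul_polylog m [1]
  have i0 := integrableOn_pow_div_mul_polylog m (ss := []) continuousOn_const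
  have i1 := integrableOn_pow_div_mul_polylog m (continuousOn_polylog_half [])
  have e : expIntegral [m, 0] = ∫ t in Set.Ioi (0 : ℝ),
      (Real.log 2 * (t ^ m / (2 * Real.exp t - 1) * polylog [] (Real.exp (-t) / 2)) -
        t ^ m / (2 * Real.exp t - 1) * polylog [1] (Real.exp (-t) / 2)) := by
    refine setIntegral_congr_fun measurableSet_Ioi fun t ht => ?_
    have h := iteratedIntegral_zero (le_of_lt ht : (0 : ℝ) ≤ t)
    simp only [List.map_cons, List.map_nil] at h ⊢
    rw [h, polylog]
    ring
  rw [e, integral_sub (i0.const_mul _) i1, integral_const_mul, h0, h1, delta_cons, delta_cons]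
  ring

/-- The inner double integral is (ln 2 - Li_1)²/2 at e^{-t}/2. Expanding, with Li_1²/2 = Li_{1,1},
leaves three integrals of known type. -/
theorem expIntegral_triple_zero (m : ℕ) :
    expIntegral [m, 0, 0] = m.factorial * (Real.log 2 ^ 2 / 2 * delta [m + 1]
      - Real.log 2 * delta [m + 1, 1] + delta [m + 1, 1, 1]) := by
  have h0 := integral_pow_div_mul_polylog m []
  have h1 := integral_pow_div_mul_polylog m [1]
  have h2 := integral_pow_div_mul_polylog m [1, 1]
  have i0 := integrableOn_pow_div_mul_polylog m (ss := []) continuousOn_const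
  have i1 := integrableOn_pow_div_mul_polylog m (continuousOn_polylog_half [])
  have i2 := integrableOn_pow_div_mul_polylog m (continuousOn_polylog_half [1])
  have e : expIntegral [m, 0, 0] = ∫ t in Set.Ioi (0 : ℝ),
      (Real.log 2 ^ 2 / 2 * (t ^ m / (2 * Real.exp t - 1) * polylog [] (Real.exp (-t) / 2)) -
        Real.log 2 * (t ^ m / (2 * Real.exp t - 1) * polylog [1] (Real.exp (-t) / 2)) +
        t ^ m / (2 * Real.exp t - 1) * polylog [1, 1] (Real.exp (-t) / 2)) := by
    refine setIntegral_congr_fun measurableSet_Ioi fun t ht => ?_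
    have ht' : (0 : ℝ) ≤ t := le_of_lt ht
    have h := iteratedIntegral_zero_zero ht'
    simp only [List.map_cons, List.map_nil] at h ⊢
    have ha := abs_exp_neg_div_two_lt_one ht'
    rw [h, polylog, polylog_one_one ha, polylog_one ha]
    ring
  have i3 : IntegrableOn (fun t : ℝ =>
      Real.log 2 ^ 2 / 2 * (t ^ m / (2 * Real.exp t - 1) * polylog [] (Real.exp (-t) / 2)) -
        Real.log 2 * (t ^ m / (2 * Real.exp t - 1) * polylog [1] (Real.exp (-t) / 2)))
      (Set.Ioi 0) := (i0.const_mul _).sub (i1.const_mul _)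
  rw [e, integral_add i3 i2,
    integral_sub (i0.const_mul _) (i1.const_mul _), integral_const_mul, integral_const_mul,
    h0, h1, h2, delta_cons, delta_cons, delta_cons]
  ring

theorem deltaIntegral_eq (l : List ℕ) :
    deltaIntegral l = ((l.map fun m => (m.factorial : ℝ)).prod)⁻¹ * expIntegral l := rfl

/-! ### Remaining words from shuffle relations. -/

section Values

theorem expIntegral_nil : expIntegral [] = 1 := rfl

theorem expIntegral_zero_zero : expIntegral [0, 0] = Real.log 2 ^ 2 / 2 := by
  have h := expIntegral_mul [0] [0]
  simp [shuffles, expIntegral_zero] at h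
  linarith

theorem expIntegral_zero_zero_zero : expIntegral [0, 0, 0] = Real.log 2 ^ 3 / 6 := by
  have h := expIntegral_mul [0] [0, 0]
  simp [shuffles, expIntegral_zero, expIntegral_zero_zero] at h
  linarith

theorem expIntegral_zero_zero_zero_zero : expIntegral [0, 0, 0, 0] = Real.log 2 ^ 4 / 24 := by
  have h := expIntegral_mul [0] [0, 0, 0]
  simp [shuffles, expIntegral_zero, expIntegral_zero_zero_zero] at h
  linarith

theorem expIntegral_zero_pair (m : ℕ) :
    expIntegral [0, m] = m.factorial * delta [m + 1, 1] := by
  have h := expIntegral_mul [0] [m]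
  rw [expIntegral_zero, expIntegral_singleton] at h
  simp [shuffles, expIntegral_pair_zero] at h
  linarith

theorem expIntegral_one_one : expIntegral [1, 1] = delta [2] ^ 2 / 2 := by
  have h := expIntegral_mul [1] [1]
  simp [shuffles, expIntegral_singleton] at h
  linarith

/-- Shuffling (0) with (1,0) gives (0,1,0) + 2(1,0,0), where only the first is unknown. -/
theorem expIntegral_zero_one_zero : expIntegral [0, 1, 0] =
    Real.log 2 * delta [2, 1] - 2 * delta [2, 1, 1] := by
  have h := expIntegral_mul [0] [1, 0]
  simp [shuffles, expIntegral_zero, expIntegral_pair_zero, expIntegral_triple_zero] at h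
  linarith

theorem expIntegral_zero_zero_one : expIntegral [0, 0, 1] = delta [2, 1, 1] := by
  have h := expIntegral_mul [0] [0, 1]
  simp [shuffles, expIntegral_zero, expIntegral_zero_pair, expIntegral_zero_one_zero] at h
  linarith

end Values

/-! ### Fourth-order coefficients of the series formulae -/

/-- Reduces a sum over compositions to an explicit list of block lists, whose completeness is linear
arithmetic. -/
theorem sum_composition_eq {M : Type*} [AddCommMonoid M] {n : ℕ} (S : Finset (List ℕ))
    (hS : ∀ l : List ℕ, l ∈ S ↔ (∀ i ∈ l, 0 < i) ∧ l.sum = n) (f : List ℕ → M) :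
    ∑ κ : Composition n, f κ.blocks = ∑ l ∈ S, f l := by
  refine Finset.sum_bij (fun κ _ => κ.blocks) (fun κ _ => ?_) (fun κ _ κ' _ h => ?_)
    (fun l hl => ?_) fun κ _ => rfl
  · exact (hS _).2 ⟨fun i hi => κ.blocks_pos hi, κ.blocks_sum⟩
  · exact Composition.ext h
  · obtain ⟨h1, h2⟩ := (hS l).1 hl
    exact ⟨⟨l, fun hi => h1 _ hi, h2⟩, Finset.mem_univ _, rfl⟩

theorem sum_composition_zero {M : Type*} [AddCommMonoid M] (f : List ℕ → M) :
    ∑ κ : Composition 0, f κ.blocks = f [] := by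
  rw [sum_composition_eq {[]}]
  · simp
  · rintro (_ | ⟨a, l⟩) <;> simp
    omega

theorem sum_composition_one {M : Type*} [AddCommMonoid M] (f : List ℕ → M) :
    ∑ κ : Composition 1, f κ.blocks = f [1] := by
  rw [sum_composition_eq {[1]}]
  · simp
  · rintro (_ | ⟨a, _ | ⟨b, l⟩⟩) <;> simp <;> omega

theorem sum_composition_two {M : Type*} [AddCommMonoid M] (f : List ℕ → M) :
    ∑ κ : Composition 2, f κ.blocks = f [2] + f [1, 1] := by
  rw [sum_composition_eq {[2], [1, 1]}]
  · simp
  · rintro (_ | ⟨a, _ | ⟨b, _ | ⟨c, l⟩⟩⟩) <;> simp <;> omega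

theorem sum_composition_three {M : Type*} [AddCommMonoid M] (f : List ℕ → M) :
    ∑ κ : Composition 3, f κ.blocks = f [3] + (f [2, 1] + (f [1, 2] + f [1, 1, 1])) := by
  rw [sum_composition_eq {[3], [2, 1], [1, 2], [1, 1, 1]}]
  · simp
  · rintro (_ | ⟨a, _ | ⟨b, _ | ⟨c, _ | ⟨d, l⟩⟩⟩⟩) <;> simp <;> omega

theorem sum_composition_four {M : Type*} [AddCommMonoid M] (f : List ℕ → M) :
    ∑ κ : Composition 4, f κ.blocks = f [4] + (f [3, 1] + (f [2, 2] + (f [1, 3] +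
      (f [2, 1, 1] + (f [1, 2, 1] + (f [1, 1, 2] + f [1, 1, 1, 1])))))) := by
  rw [sum_composition_eq {[4], [3, 1], [2, 2], [1, 3], [2, 1, 1], [1, 2, 1], [1, 1, 2],
    [1, 1, 1, 1]}]
  · simp
  · rintro (_ | ⟨a, _ | ⟨b, _ | ⟨c, _ | ⟨d, _ | ⟨e, l⟩⟩⟩⟩⟩) <;> simp <;> omega

/-! ### Coefficients of Ξ and removal of the inverse. -/

section Associator

variable {𝒜 : Type*} [Ring 𝒜] [Algebra ℂ 𝒜] (A B : 𝒜)

theorem coeff_zero_xiSeries : PowerSeries.coeff 0 (xiSeries B A) = 1 := by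
  rw [xiSeries, PowerSeries.coeff_mk, sum_composition_zero (fun l =>
    (deltaIntegral (l.map fun m => m - 1) : ℂ) • (l.map fun m => adPow B (m - 1) A).prod)]
  simp [deltaIntegral_eq, expIntegral_nil]

theorem coeff_one_xiSeries :
    PowerSeries.coeff 1 (xiSeries B A) = (Real.log 2 : ℂ) • A := by
  rw [xiSeries, PowerSeries.coeff_mk, sum_composition_one (fun l =>
    (deltaIntegral (l.map fun m => m - 1) : ℂ) • (l.map fun m => adPow B (m - 1) A).prod)]
  simp [deltaIntegral_eq, expIntegral_zero, adPow]

theorem coeff_two_xiSeries :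
    PowerSeries.coeff 2 (xiSeries B A) =
      (delta [2] : ℂ) • ⁅B, A⁆ + ((Real.log 2 : ℂ) ^ 2 / 2) • (A * A) := by
  rw [xiSeries, PowerSeries.coeff_mk, sum_composition_two (fun l =>
    (deltaIntegral (l.map fun m => m - 1) : ℂ) • (l.map fun m => adPow B (m - 1) A).prod)]
  simp [deltaIntegral_eq, expIntegral_singleton, expIntegral_zero_zero, adPow]

theorem coeff_three_xiSeries :
    PowerSeries.coeff 3 (xiSeries B A) =
      (delta [3] : ℂ) • ⁅B, ⁅B, A⁆⁆
      + ((Real.log 2 * delta [2] - delta [2, 1] : ℂ) • (⁅B, A⁆ * A)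
      + ((delta [2, 1] : ℂ) • (A * ⁅B, A⁆)
      + ((Real.log 2 : ℂ) ^ 3 / 6) • (A * (A * A)))) := by
  rw [xiSeries, PowerSeries.coeff_mk, sum_composition_three (fun l =>
    (deltaIntegral (l.map fun m => m - 1) : ℂ) • (l.map fun m => adPow B (m - 1) A).prod)]
  simp [deltaIntegral_eq, expIntegral_singleton, expIntegral_zero_zero_zero,
    expIntegral_pair_zero, expIntegral_zero_pair, adPow]

theorem coeff_four_xiSeries :
    PowerSeries.coeff 4 (xiSeries B A) =
      (delta [4] : ℂ) • ⁅B, ⁅B, ⁅B, A⁆⁆⁆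
      + ((Real.log 2 * delta [3] - delta [3, 1] : ℂ) • (⁅B, ⁅B, A⁆⁆ * A)
      + (((delta [2] : ℂ) ^ 2 / 2) • (⁅B, A⁆ * ⁅B, A⁆)
      + ((delta [3, 1] : ℂ) • (A * ⁅B, ⁅B, A⁆⁆)
      + (((Real.log 2 : ℂ) ^ 2 / 2 * delta [2] - Real.log 2 * delta [2, 1] + delta [2, 1, 1])
          • (⁅B, A⁆ * (A * A))
      + ((Real.log 2 * delta [2, 1] - 2 * delta [2, 1, 1] : ℂ) • (A * (⁅B, A⁆ * A))
      + ((delta [2, 1, 1] : ℂ) • (A * (A * ⁅B, A⁆))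
      + ((Real.log 2 : ℂ) ^ 4 / 24) • (A * (A * (A * A))))))))) := by
  rw [xiSeries, PowerSeries.coeff_mk, sum_composition_four (fun l =>
    (deltaIntegral (l.map fun m => m - 1) : ℂ) • (l.map fun m => adPow B (m - 1) A).prod)]
  have h6 : (Nat.factorial 3 : ℝ) ≠ 0 := by positivity
  simp only [deltaIntegral_eq, expIntegral_singleton, expIntegral_zero_zero_zero_zero,
    expIntegral_pair_zero, expIntegral_zero_pair, expIntegral_triple_zero, expIntegral_one_one,
    expIntegral_zero_one_zero, expIntegral_zero_zero_one, adPow, List.map_cons, List.map_nil,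
    List.prod_cons, List.prod_nil, Nat.add_one_sub_one, Nat.sub_self,
    Function.iterate_succ, Function.iterate_zero, Function.comp, id, mul_one]
  simp [Nat.factorial_succ]

theorem expSeries_mul_expSeries_neg (a : ℝ) : expSeries (-a) A * expSeries a A = 1 := by
  ext n
  rw [PowerSeries.coeff_mul, PowerSeries.coeff_one]
  simp only [expSeries, PowerSeries.coeff_mk, smul_mul_smul_comm, ← pow_add]
  have h : ∀ p ∈ Finset.HasAntidiagonal.antidiagonal n,
      ((((-a) ^ p.1 / p.1.factorial : ℝ) : ℂ) * ((a ^ p.2 / p.2.factorial : ℝ) : ℂ)) •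
        A ^ (p.1 + p.2) =
      (((((-a) ^ p.1 * a ^ p.2 * n.choose p.1 : ℝ) / n.factorial : ℝ) : ℂ)) • A ^ n := by
    intro p hp
    rw [Finset.HasAntidiagonal.mem_antidiagonal] at hp
    subst hp
    congr 1
    rw [← Complex.ofReal_mul, Nat.choose_symm_add, Nat.add_choose, Nat.cast_div
      (Nat.factorial_mul_factorial_dvd_factorial_add _ _) (by positivity)]
    congr 1
    push_cast
    field_simp
  rw [Finset.sum_congr rfl h, ← Finset.sum_smul, ← Complex.ofReal_sum, ← Finset.sum_div]
  have hb := (Commute.all (-a) a).add_pow' n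
  simp only [nsmul_eq_mul] at hb
  -- Binomial theorem for (-a + a)^n, which is 0 unless n = 0.
  have e : ∑ p ∈ Finset.HasAntidiagonal.antidiagonal n, (-a) ^ p.1 * a ^ p.2 * n.choose p.1 = (-a + a) ^ n := by
    rw [hb]
    exact Finset.sum_congr rfl fun p _ => mul_comm _ _
  rw [e, neg_add_cancel]
  split_ifs with hn
  · subst hn
    simp
  · simp [hn]

theorem constantCoeff_xiSeries : PowerSeries.constantCoeff (xiSeries B A) = 1 := by
  rw [← PowerSeries.coeff_zero_eq_constantCoeff_apply, coeff_zero_xiSeries]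

/-- Multiplying out the inverse and the last exponential leaves a relation that is triangular in the
coefficients of the associator. -/
theorem associatorDelta_mul :
    associatorDelta A B * (expSeries (Real.log 2) A * xiSeries A B) =
      expSeries (Real.log 2) B * xiSeries B A := by
  have h := PowerSeries.invOfUnit_mul (xiSeries A B) 1 (by simpa using constantCoeff_xiSeries B A)
  rw [associatorDelta, mul_assoc, ← mul_assoc (expSeries (-Real.log 2) A),
    expSeries_mul_expSeries_neg, one_mul, mul_assoc, h, mul_one]

theorem coeff_expSeries (a : ℝ) (n : ℕ) :
    PowerSeries.coeff n (expSeries a A) = ((a : ℂ) ^ n / n.factorial) • A ^ n := by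
  simp [expSeries]

end Associator

section CoeffMul

variable {𝒜 : Type*} [Ring 𝒜]

theorem coeff_four_mul (φ ψ : PowerSeries 𝒜) : PowerSeries.coeff 4 (φ * ψ) =
    PowerSeries.coeff 0 φ * PowerSeries.coeff 4 ψ + PowerSeries.coeff 1 φ * PowerSeries.coeff 3 ψ
    + PowerSeries.coeff 2 φ * PowerSeries.coeff 2 ψ
    + PowerSeries.coeff 3 φ * PowerSeries.coeff 1 ψ
    + PowerSeries.coeff 4 φ * PowerSeries.coeff 0 ψ := by
  rw [PowerSeries.coeff_mul, Finset.Nat.sum_antidiagonal_eq_sum_range_succ_mk]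
  simp [Finset.sum_range_succ]

theorem coeff_three_mul (φ ψ : PowerSeries 𝒜) : PowerSeries.coeff 3 (φ * ψ) =
    PowerSeries.coeff 0 φ * PowerSeries.coeff 3 ψ + PowerSeries.coeff 1 φ * PowerSeries.coeff 2 ψ
    + PowerSeries.coeff 2 φ * PowerSeries.coeff 1 ψ
    + PowerSeries.coeff 3 φ * PowerSeries.coeff 0 ψ := by
  rw [PowerSeries.coeff_mul, Finset.Nat.sum_antidiagonal_eq_sum_range_succ_mk]
  simp [Finset.sum_range_succ]

theorem coeff_two_mul (φ ψ : PowerSeries 𝒜) : PowerSeries.coeff 2 (φ * ψ) =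
    PowerSeries.coeff 0 φ * PowerSeries.coeff 2 ψ + PowerSeries.coeff 1 φ * PowerSeries.coeff 1 ψ
    + PowerSeries.coeff 2 φ * PowerSeries.coeff 0 ψ := by
  rw [PowerSeries.coeff_mul, Finset.Nat.sum_antidiagonal_eq_sum_range_succ_mk]
  simp [Finset.sum_range_succ]

theorem coeff_one_mul_ring (φ ψ : PowerSeries 𝒜) : PowerSeries.coeff 1 (φ * ψ) =
    PowerSeries.coeff 0 φ * PowerSeries.coeff 1 ψ
    + PowerSeries.coeff 1 φ * PowerSeries.coeff 0 ψ := by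
  rw [PowerSeries.coeff_mul, Finset.Nat.sum_antidiagonal_eq_sum_range_succ_mk]
  simp [Finset.sum_range_succ]

end CoeffMul

/-! ### Solving for the delta-value associator through degree four. -/

section Associator

variable {𝒜 : Type*} [Ring 𝒜] [Algebra ℂ 𝒜] (A B : 𝒜)

/-- The product `e ^ {ħ ln(2) B} Ξ_{B,A}`. -/
noncomputable def expXi : PowerSeries 𝒜 := expSeries (Real.log 2) B * xiSeries B A

theorem coeff_zero_expXi : PowerSeries.coeff 0 (expXi A B) = 1 := by
  rw [expXi, PowerSeries.coeff_mul]
  simp [coeff_expSeries, coeff_zero_xiSeries]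

theorem coeff_one_expXi :
    PowerSeries.coeff 1 (expXi A B) = (Real.log 2 : ℂ) • (A + B) := by
  rw [expXi, coeff_one_mul_ring]
  simp [coeff_expSeries, coeff_zero_xiSeries, coeff_one_xiSeries]

theorem coeff_two_expXi :
    PowerSeries.coeff 2 (expXi A B) =
      ((Real.log 2 : ℂ) ^ 2 / 2) • (A * A + B * B)
      + (delta [2] + (Real.log 2 : ℂ) ^ 2) • (B * A) - (delta [2] : ℂ) • (A * B) := by
  rw [expXi, coeff_two_mul]
  simp only [coeff_expSeries, coeff_zero_xiSeries, coeff_one_xiSeries, coeff_two_xiSeries,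
    Ring.lie_def, smul_mul_assoc, mul_smul_comm, pow_succ, pow_zero, one_mul, mul_one,
    Nat.factorial]
  generalize (Real.log 2 : ℂ) = L
  module

/-- The constants enter as complex parameters, so that `module` sees polynomial scalars acting on
right-nested words. -/
theorem coeff_three_expXi {L d2 d3 d21 : ℂ} (hL : (Real.log 2 : ℂ) = L)
    (h2 : (delta [2] : ℂ) = d2) (h3 : (delta [3] : ℂ) = d3) (h21 : (delta [2, 1] : ℂ) = d21) :
    PowerSeries.coeff 3 (expXi A B) =
      (1 / 6 * L ^ 3) • (A * (A * A)) + (2 * d21 - L * d2) • (A * (B * A))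
      + (-d21) • (A * (A * B)) + (L * d2 - d21 + 1 / 2 * L ^ 3) • (B * (A * A))
      + (d3 + L * d2 + 1 / 2 * L ^ 3) • (B * (B * A)) + (-2 * d3 - L * d2) • (B * (A * B))
      + d3 • (A * (B * B)) + (1 / 6 * L ^ 3) • (B * (B * B)) := by
  rw [expXi, coeff_three_mul]
  simp only [coeff_expSeries, coeff_zero_xiSeries, coeff_one_xiSeries, coeff_two_xiSeries,
    coeff_three_xiSeries, hL, h2, h3, h21,
    Ring.lie_def, smul_mul_assoc, mul_smul_comm, pow_succ, pow_zero, one_mul, mul_one,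
    mul_add, mul_sub, sub_mul, smul_sub, mul_assoc,
    Nat.factorial]
  push_cast
  module

theorem coeff_four_expXi {L d2 d3 d4 d21 d31 d211 : ℂ} (hL : (Real.log 2 : ℂ) = L)
    (h2 : (delta [2] : ℂ) = d2) (h3 : (delta [3] : ℂ) = d3) (h4 : (delta [4] : ℂ) = d4)
    (h21 : (delta [2, 1] : ℂ) = d21) (h31 : (delta [3, 1] : ℂ) = d31)
    (h211 : (delta [2, 1, 1] : ℂ) = d211) :
    PowerSeries.coeff 4 (expXi A B) =
      ((1/24) * L ^ 4) • (A * (A * (A * A)))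
      + ((3) * d211 + (-1) * L * d21) • (A * (A * (B * A)))
      + ((-1) * d211) • (A * (A * (A * B)))
      + ((2) * L * d21 + (-3) * d211 + (-1/2) * L ^ 2 * d2) • (A * (B * (A * A)))
      + ((-1/2) * d2 ^ 2 + L * d3) • (A * (B * (B * A)))
      + ((-2) * d31 + (1/2) * d2 ^ 2) • (A * (B * (A * B)))
      + (d31) • (A * (A * (B * B)))
      + ((1/2) * L ^ 2 * d2 + (-1) * L * d21 + d211 + (1/6) * L ^ 4) • (B * (A * (A * A)))
      + ((1/2) * d2 ^ 2 + (-2) * L * d3 + (2) * d31 + (2) * L * d21 + (-1) * L ^ 2 * d2) • (B * (A * (B * A)))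
      + ((-1/2) * d2 ^ 2 + (-1) * L * d21) • (B * (A * (A * B)))
      + (L * d3 + (-1) * d31 + L ^ 2 * d2 + (-1) * L * d21 + (1/4) * L ^ 4) • (B * (B * (A * A)))
      + (d4 + L * d3 + (1/2) * L ^ 2 * d2 + (1/6) * L ^ 4) • (B * (B * (B * A)))
      + ((-3) * d4 + (-2) * L * d3 + (-1/2) * L ^ 2 * d2) • (B * (B * (A * B)))
      + ((3) * d4 + L * d3) • (B * (A * (B * B)))
      + ((-1) * d4) • (A * (B * (B * B)))
      + ((1/24) * L ^ 4) • (B * (B * (B * B))) := by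
  rw [expXi, coeff_four_mul]
  simp only [coeff_expSeries, coeff_zero_xiSeries, coeff_one_xiSeries, coeff_two_xiSeries,
    coeff_three_xiSeries, coeff_four_xiSeries, hL, h2, h3, h4, h21, h31, h211,
    Ring.lie_def, smul_mul_assoc, mul_smul_comm, pow_succ, pow_zero, one_mul, mul_one,
    mul_add, mul_sub, sub_mul, smul_sub, mul_assoc,
    Nat.factorial]
  push_cast
  module

theorem associatorDelta_mul_expXi : associatorDelta A B * expXi B A = expXi A B :=
  associatorDelta_mul A B

theorem coeff_zero_associatorDelta : PowerSeries.coeff 0 (associatorDelta A B) = 1 := by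
  have h := congrArg (PowerSeries.coeff 0) (associatorDelta_mul_expXi A B)
  rw [PowerSeries.coeff_mul] at h
  simpa [coeff_zero_expXi] using h

theorem coeff_one_associatorDelta : PowerSeries.coeff 1 (associatorDelta A B) = 0 := by
  have h := congrArg (PowerSeries.coeff 1) (associatorDelta_mul_expXi A B)
  rw [coeff_one_mul_ring, coeff_zero_associatorDelta, coeff_zero_expXi, coeff_one_expXi,
    coeff_one_expXi, one_mul, mul_one, add_comm A B] at h
  simpa using h

theorem coeff_two_associatorDelta : PowerSeries.coeff 2 (associatorDelta A B) =
    (2 * delta [2] + (Real.log 2 : ℂ) ^ 2) • (B * A - A * B) := by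
  have h := congrArg (PowerSeries.coeff 2) (associatorDelta_mul_expXi A B)
  rw [coeff_two_mul, coeff_zero_associatorDelta, coeff_one_associatorDelta, coeff_zero_expXi,
    zero_mul, add_zero, one_mul, mul_one] at h
  rw [eq_sub_of_add_eq' h, coeff_two_expXi, coeff_two_expXi]
  generalize (Real.log 2 : ℂ) = L
  module

/-- The combination of words is [A, X] + [B, X] with X = [B, A], left expanded for use in degree 4.
-/
theorem coeff_three_associatorDelta {L d2 d3 d21 : ℂ} (hL : (Real.log 2 : ℂ) = L)
    (h2 : (delta [2] : ℂ) = d2) (h3 : (delta [3] : ℂ) = d3) (h21 : (delta [2, 1] : ℂ) = d21) :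
    PowerSeries.coeff 3 (associatorDelta A B) = (L * d2 + 1 / 2 * L ^ 3 + d3 + d21) •
      (2 • (A * (B * A)) - A * (A * B) - B * (A * A) + B * (B * A) + A * (B * B)
        - 2 • (B * (A * B))) := by
  have h := congrArg (PowerSeries.coeff 3) (associatorDelta_mul_expXi A B)
  rw [coeff_three_mul, coeff_zero_associatorDelta, coeff_one_associatorDelta,
    coeff_zero_expXi, zero_mul, add_zero, one_mul, mul_one, coeff_two_associatorDelta,
    coeff_one_expXi, hL, h2] at h
  have e : PowerSeries.coeff 3 (associatorDelta A B) =
      PowerSeries.coeff 3 (expXi A B) - PowerSeries.coeff 3 (expXi B A)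
        - (2 * d2 + L ^ 2) • (B * A - A * B) * L • (B + A) := by
    rw [← h]
    abel
  rw [e, coeff_three_expXi A B hL h2 h3 h21, coeff_three_expXi B A hL h2 h3 h21]
  simp only [smul_mul_assoc, mul_smul_comm, mul_add, sub_mul, mul_assoc]
  module

/-- The degree-1 coefficient vanishes, so only degrees 2 and 3 are subtracted. The factor 2d2 + L²
is ζ_2 by the dilogarithm reflection at 1/2. -/
theorem coeff_four_associatorDelta {L d2 d3 d4 d21 d31 d211 : ℂ} (hL : (Real.log 2 : ℂ) = L)
    (h2 : (delta [2] : ℂ) = d2) (h3 : (delta [3] : ℂ) = d3) (h4 : (delta [4] : ℂ) = d4)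
    (h21 : (delta [2, 1] : ℂ) = d21) (h31 : (delta [3, 1] : ℂ) = d31)
    (h211 : (delta [2, 1, 1] : ℂ) = d211) :
    PowerSeries.coeff 4 (associatorDelta A B) =
      (d211 + 1 / 6 * L ^ 4 + 1 / 2 * d2 * L ^ 2 + d3 * L + d4) •
          (⁅A, ⁅A, ⁅B, A⁆⁆⁆ + ⁅B, ⁅B, ⁅B, A⁆⁆⁆)
        + ((2 * d2 + L ^ 2) ^ 2 / 2) • ⁅B, A⁆ ^ 2
        + (2 * d31 + 2 * d21 * L + 1 / 4 * L ^ 4) • ⁅A, ⁅B, ⁅B, A⁆⁆⁆ := by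
  have h := congrArg (PowerSeries.coeff 4) (associatorDelta_mul_expXi A B)
  rw [coeff_four_mul, coeff_zero_associatorDelta, coeff_one_associatorDelta,
    coeff_zero_expXi, zero_mul, add_zero, one_mul, mul_one, coeff_two_associatorDelta,
    coeff_three_associatorDelta A B hL h2 h3 h21, hL, h2] at h
  have e : PowerSeries.coeff 4 (associatorDelta A B) =
      PowerSeries.coeff 4 (expXi A B) - PowerSeries.coeff 4 (expXi B A)
        - (2 * d2 + L ^ 2) • (B * A - A * B) * PowerSeries.coeff 2 (expXi B A)
        - (L * d2 + 1 / 2 * L ^ 3 + d3 + d21) • (2 • (A * (B * A)) - A * (A * B) - B * (A * A)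
          + B * (B * A) + A * (B * B) - 2 • (B * (A * B))) *
            PowerSeries.coeff 1 (expXi B A) := by
    rw [← h]
    abel
  rw [e, coeff_four_expXi A B hL h2 h3 h4 h21 h31 h211,
    coeff_four_expXi B A hL h2 h3 h4 h21 h31 h211, coeff_one_expXi, coeff_two_expXi, hL, h2]
  simp only [Ring.lie_def, pow_two, smul_mul_assoc, mul_smul_comm, mul_add, mul_sub, sub_mul, add_mul,
    mul_assoc]
  module

end Associator

/-! ### The fourth-order term with multiple zeta values. -/

section AssociatorMZV

theorem exponentTuples_four_one : exponentTuples 4 1 = {![(1, 3)], ![(2, 2)], ![(3, 1)]} := by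
  decide

theorem exponentTuples_four_two : exponentTuples 4 2 = {![(1, 1), (1, 1)]} := by
  ext e
  simp only [exponentTuples, Finset.mem_filter, Fintype.mem_piFinset, Finset.mem_product,
    Finset.mem_Icc, Fin.forall_fin_two, Fin.sum_univ_two, Finset.mem_singleton, funext_iff,
    Matrix.cons_val_zero, Matrix.cons_val_one, Prod.ext_iff]
  omega

theorem exponentTuples_eq_empty {r g : ℕ} (h : r < 2 * g) : exponentTuples r g = ∅ := by
  refine Finset.filter_eq_empty_iff.2 fun e he hs => ?_
  have h1 : ∑ _i : Fin g, 2 ≤ ∑ i, ((e i).1 + (e i).2) := Finset.sum_le_sum fun i _ => by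
    have h2 := Fintype.mem_piFinset.1 he i
    simp only [Finset.mem_product, Finset.mem_Icc] at h2
    omega
  simp at h1
  omega

theorem sum_piFinset_one {M : Type*} [AddCommMonoid M] (S : Fin 1 → Finset ℕ)
    (f : (Fin 1 → ℕ) → M) : ∑ s ∈ Fintype.piFinset S, f s = ∑ a ∈ S 0, f ![a] := by
  refine Finset.sum_bij' (fun s _ => s 0) (fun a _ => ![a]) (fun s hs => ?_) (fun a ha => ?_)
    (fun s _ => ?_) (fun a _ => rfl) fun s _ => ?_
  · exact Fintype.mem_piFinset.1 hs 0
  · simpa [Fintype.mem_piFinset] using ha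
  · ext i
    fin_cases i
    rfl
  · congr 1
    ext i
    fin_cases i
    rfl

theorem sum_piFinset_two {M : Type*} [AddCommMonoid M] (S : Fin 2 → Finset ℕ)
    (f : (Fin 2 → ℕ) → M) :
    ∑ s ∈ Fintype.piFinset S, f s = ∑ a ∈ S 0, ∑ b ∈ S 1, f ![a, b] := by
  rw [← Finset.sum_product']
  refine Finset.sum_bij' (fun s _ => (s 0, s 1)) (fun p _ => ![p.1, p.2]) (fun s hs => ?_)
    (fun p hp => ?_) (fun s _ => ?_) (fun p _ => rfl) fun s _ => ?_
  · exact Finset.mem_product.2 ⟨Fintype.mem_piFinset.1 hs 0, Fintype.mem_piFinset.1 hs 1⟩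
  · simpa [Fintype.mem_piFinset, Fin.forall_fin_two] using hp
  · ext i
    fin_cases i <;> rfl
  · congr 1
    ext i
    fin_cases i <;> rfl

variable {𝒜 : Type*} [Ring 𝒜]

theorem mzvMonomialSum_single (A B : 𝒜) (p q : ℕ) : mzvMonomialSum A B ![(p, q)] =
    ∑ s ∈ Finset.range (p + 1), ∑ t ∈ Finset.range (q + 1),
      ((-1 : ℤ) ^ (s + t) * p.choose s * q.choose t) •
        (B ^ t * (A ^ (p - s) * B ^ (q - t)) * A ^ s) := by
  rw [mzvMonomialSum, sum_piFinset_one]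
  refine Finset.sum_congr rfl fun s _ => ?_
  rw [sum_piFinset_one]
  refine Finset.sum_congr rfl fun t _ => ?_
  simp

theorem mzvMonomialSum_pair (A B : 𝒜) (p q p' q' : ℕ) : mzvMonomialSum A B ![(p, q), (p', q')] =
    ∑ s ∈ Finset.range (p + 1), ∑ s' ∈ Finset.range (p' + 1),
    ∑ t ∈ Finset.range (q + 1), ∑ t' ∈ Finset.range (q' + 1),
      ((-1 : ℤ) ^ (s + t) * p.choose s * q.choose t *
        ((-1 : ℤ) ^ (s' + t') * p'.choose s' * q'.choose t')) •
        (B ^ (t + t') * (A ^ (p - s) * B ^ (q - t) * (A ^ (p' - s') * B ^ (q' - t'))) *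
          A ^ (s + s')) := by
  rw [mzvMonomialSum, sum_piFinset_two]
  refine Finset.sum_congr rfl fun s _ => Finset.sum_congr rfl fun s' _ => ?_
  rw [sum_piFinset_two]
  refine Finset.sum_congr rfl fun t _ => Finset.sum_congr rfl fun t' _ => ?_
  simp

theorem coeff_four_associatorMZV [Algebra ℂ 𝒜] (A B : 𝒜) : PowerSeries.coeff 4 (associatorMZV A B) =
    ((polylog [4] 1 : ℝ) : ℂ) • (⁅A, ⁅A, ⁅B, A⁆⁆⁆ + ⁅B, ⁅B, ⁅B, A⁆⁆⁆)
      + (5 / 4 * ((polylog [4] 1 : ℝ) : ℂ)) • ⁅B, A⁆ ^ 2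
      + ((1 / 4) * ((polylog [4] 1 : ℝ) : ℂ)) • ⁅A, ⁅B, ⁅B, A⁆⁆⁆ := by
  have hI : Finset.Icc 1 4 = {1, 2, 3, 4} := by decide
  have z4 : mzv [4] = polylog [4] 1 := mzv_cons (summable_liCoeff (by simp))
  have z31 : mzv [3, 1] = polylog [4] 1 / 4 := by
    rw [mzv_cons (summable_liCoeff (by simp)), polylog_three_one_at_one]
  have z211 : mzv [2, 1, 1] = polylog [4] 1 := by
    rw [mzv_cons summable_liCoeff_two_one_one, polylog_two_one_one_at_one]
  have z22 : mzv [2, 2] = 3 / 4 * polylog [4] 1 := by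
    rw [mzv_cons hasSum_liCoeff_two_two.summable, polylog_two_two_at_one, polylog_two_sq_eq]
    ring
  have i1 : mzvIndex ![(1, 3)] = [2, 1, 1] := by decide
  have i2 : mzvIndex ![(2, 2)] = [3, 1] := by decide
  have i3 : mzvIndex ![(3, 1)] = [4] := by decide
  have i4 : mzvIndex ![(1, 1), (1, 1)] = [2, 2] := by decide
  rw [associatorMZV, map_add, PowerSeries.coeff_mk, PowerSeries.coeff_one, if_neg (by norm_num),
    zero_add, hI, Finset.sum_insert (by decide), Finset.sum_insert (by decide),
    Finset.sum_insert (by decide), Finset.sum_singleton, exponentTuples_four_one,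
    exponentTuples_four_two, exponentTuples_eq_empty (by norm_num),
    exponentTuples_eq_empty (by norm_num), Finset.sum_empty, Finset.sum_empty,
    Finset.sum_insert (by decide), Finset.sum_insert (by decide), Finset.sum_singleton,
    Finset.sum_singleton, i1, i2, i3, i4, z4, z31, z211, z22, mzvMonomialSum_single,
    mzvMonomialSum_single, mzvMonomialSum_single, mzvMonomialSum_pair]
  -- All four zeta values are now multiples of ζ_4, namely 1, 1/4, 1 and 3/4 times it, so the rest
  -- is linear algebra on words.
  generalize polylog [4] 1 = z
  simp only [Fin.sum_univ_one, Fin.sum_univ_two, Matrix.cons_val_zero, Matrix.cons_val_one,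
    Finset.sum_range_succ, Finset.sum_range_zero, zero_add, add_zero, Nat.choose, Nat.sub_zero,
    Nat.sub_self, Nat.reduceSub, Nat.reduceAdd, pow_succ, pow_zero, one_mul, mul_one, Ring.lie_def,
    mul_sub, sub_mul, mul_assoc]
  push_cast
  module

end AssociatorMZV

/-- In the monoid algebra of the free monoid, the words baaa, baab and aabb each occur in exactly
one of the three elements, in that order. -/
theorem linearIndependent_brackets (a b : FreeAlgebra ℂ (Fin 2))
    (ha : a = FreeAlgebra.ι ℂ 0) (hb : b = FreeAlgebra.ι ℂ 1) :
    LinearIndependent ℂ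
      ![⁅a, ⁅a, ⁅b, a⁆⁆⁆ + ⁅b, ⁅b, ⁅b, a⁆⁆⁆, ⁅b, a⁆ ^ 2, ⁅a, ⁅b, ⁅b, a⁆⁆⁆] := by
  let e := FreeAlgebra.equivMonoidAlgebraFreeMonoid (R := ℂ) (X := Fin 2)
  have hea : e a = MonoidAlgebra.single (FreeMonoid.ofList [0]) 1 := by
    simp [e, ha, FreeAlgebra.equivMonoidAlgebraFreeMonoid]
  have heb : e b = MonoidAlgebra.single (FreeMonoid.ofList [1]) 1 := by
    simp [e, hb, FreeAlgebra.equivMonoidAlgebraFreeMonoid]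
  rw [Fintype.linearIndependent_iff]
  intro g hg
  have h := congrArg e hg
  simp only [Fin.sum_univ_three, Matrix.cons_val_zero, Matrix.cons_val_one, Matrix.cons_val_two,
    Matrix.tail_cons, Matrix.head_cons, Ring.lie_def, map_add, map_smul, map_sub, map_mul,
    map_zero, hea, heb, pow_two, mul_sub, sub_mul, MonoidAlgebra.single_mul_single, mul_one] at h
  have hc : ∀ u w : List (Fin 2), (MonoidAlgebra.single (FreeMonoid.ofList u) (1 : ℂ)).coeff
      (FreeMonoid.ofList w) = if u = w then 1 else 0 := fun u w => by
    classical
    simp [Finsupp.single_apply, FreeMonoid.ofList.injective.eq_iff]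
  have hw := fun w => DFunLike.congr_fun (congrArg MonoidAlgebra.coeff h) (FreeMonoid.ofList w)
  simp only [← FreeMonoid.ofList_append, List.cons_append, List.nil_append,
    MonoidAlgebra.coeff_add, MonoidAlgebra.coeff_sub, MonoidAlgebra.coeff_smul,
    MonoidAlgebra.coeff_zero, Finsupp.add_apply, Finsupp.sub_apply, Finsupp.smul_apply,
    Finsupp.zero_apply, hc, smul_eq_mul] at hw
  have h0 := hw [1, 0, 0, 0]
  have h1 := hw [1, 0, 0, 1]
  have h2 := hw [0, 0, 1, 1]
  simp at h0 h1 h2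
  intro i
  fin_cases i
  · exact h0
  · exact h1
  · exact h2

/-! ### Convergence of delta values and the final statement. -/

theorem summable_delta {s : ℕ} {ss : List ℕ} :
    Summable (multiPolylogTerm (s :: ss) (singleArg (s :: ss).length (1 / 2))) :=
  (hasSum_multiPolylogTerm (by norm_num)
    (hasSum_polylog (summable_polylog s ss (by norm_num [abs_of_pos])))).summable

theorem riemannZeta_four_eq_polylog : riemannZeta 4 = ((polylog [4] 1 : ℝ) : ℂ) := by
  rw [riemannZeta_four, polylog_four_one]
  push_cast
  rfl

theorem riemannZeta_two_eq_polylog : riemannZeta 2 = ((polylog [2] 1 : ℝ) : ℂ) := by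
  rw [riemannZeta_two, polylog_two_one]
  push_cast
  rfl

theorem mainTheorem5 {𝒜 : Type*} [Ring 𝒜] [Algebra ℂ 𝒜] (A B : 𝒜) :
    -- all the series defining the delta values below converge
    (∀ s ∈ [[2], [3], [4], [2, 1], [3, 1], [2, 1, 1]],
      Summable (multiPolylogTerm s (singleArg s.length (1 / 2)))) ∧
    -- the fourth-order term of the expansion with multiple zeta values
    PowerSeries.coeff 4 (associatorMZV A B) =
        riemannZeta 4 • (⁅A, ⁅A, ⁅B, A⁆⁆⁆ + ⁅B, ⁅B, ⁅B, A⁆⁆⁆)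
        + (riemannZeta 2 ^ 2 / 2) • ⁅B, A⁆ ^ 2
        + ((1 / 4) * riemannZeta 4) • ⁅A, ⁅B, ⁅B, A⁆⁆⁆ ∧
    -- the fourth-order term of the expansion with delta values
    PowerSeries.coeff 4 (associatorDelta A B) =
        ((delta [2, 1, 1] + (1 / 6) * Real.log 2 ^ 4 + (1 / 2) * delta [2] * Real.log 2 ^ 2
          + delta [3] * Real.log 2 + delta [4] : ℝ) : ℂ) •
            (⁅A, ⁅A, ⁅B, A⁆⁆⁆ + ⁅B, ⁅B, ⁅B, A⁆⁆⁆)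
        + (riemannZeta 2 ^ 2 / 2) • ⁅B, A⁆ ^ 2
        + ((2 * delta [3, 1] + 2 * delta [2, 1] * Real.log 2
          + (1 / 4) * Real.log 2 ^ 4 : ℝ) : ℂ) • ⁅A, ⁅B, ⁅B, A⁆⁆⁆ ∧
    -- the two fourth-order terms agree
    PowerSeries.coeff 4 (associatorMZV A B) = PowerSeries.coeff 4 (associatorDelta A B) ∧
    -- coefficients may be compared: for free variables the three elements are independent
    (∀ a b : FreeAlgebra ℂ (Fin 2), a = FreeAlgebra.ι ℂ 0 → b = FreeAlgebra.ι ℂ 1 →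
      LinearIndependent ℂ
        ![⁅a, ⁅a, ⁅b, a⁆⁆⁆ + ⁅b, ⁅b, ⁅b, a⁆⁆⁆, ⁅b, a⁆ ^ 2, ⁅a, ⁅b, ⁅b, a⁆⁆⁆]) ∧
    -- comparing the coefficients of `[A, [B, X]]`, where `X = [B, A]`
    (1 / 4) * riemannZeta 4 =
      ((2 * delta [3, 1] + 2 * delta [2, 1] * Real.log 2 + (1 / 4) * Real.log 2 ^ 4 : ℝ) : ℂ) ∧
    -- comparing the coefficients of `[A, [A, X]] + [B, [B, X]]`: Hölder convolution with `n = 2`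
    riemannZeta 4 =
      ((delta [2, 1, 1] + (1 / 6) * Real.log 2 ^ 4 + (1 / 2) * delta [2] * Real.log 2 ^ 2
        + delta [3] * Real.log 2 + delta [4] : ℝ) : ℂ) := by
  have hz2 : (riemannZeta 2 ^ 2 / 2 : ℂ) = 5 / 4 * ((polylog [4] 1 : ℝ) : ℂ) := by
    rw [riemannZeta_two_eq_polylog, ← Complex.ofReal_pow, polylog_two_sq_eq]
    push_cast
    ring
  have ha : riemannZeta 4 =
      ((delta [2, 1, 1] + (1 / 6) * Real.log 2 ^ 4 + (1 / 2) * delta [2] * Real.log 2 ^ 2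
        + delta [3] * Real.log 2 + delta [4] : ℝ) : ℂ) := by
    rw [riemannZeta_four_eq_polylog, polylog_four_at_one_eq_delta]
  have hg : (1 / 4) * riemannZeta 4 =
      ((2 * delta [3, 1] + 2 * delta [2, 1] * Real.log 2 + (1 / 4) * Real.log 2 ^ 4 : ℝ) : ℂ) := by
    rw [riemannZeta_four_eq_polylog, ← polylog_three_one_at_one_eq_delta,
      polylog_three_one_at_one]
    push_cast
    ring
  have hM : PowerSeries.coeff 4 (associatorMZV A B) =
      riemannZeta 4 • (⁅A, ⁅A, ⁅B, A⁆⁆⁆ + ⁅B, ⁅B, ⁅B, A⁆⁆⁆)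
        + (riemannZeta 2 ^ 2 / 2) • ⁅B, A⁆ ^ 2
        + ((1 / 4) * riemannZeta 4) • ⁅A, ⁅B, ⁅B, A⁆⁆⁆ := by
    rw [coeff_four_associatorMZV, hz2, riemannZeta_four_eq_polylog]
  have hD : PowerSeries.coeff 4 (associatorDelta A B) =
      ((delta [2, 1, 1] + (1 / 6) * Real.log 2 ^ 4 + (1 / 2) * delta [2] * Real.log 2 ^ 2
        + delta [3] * Real.log 2 + delta [4] : ℝ) : ℂ) •
          (⁅A, ⁅A, ⁅B, A⁆⁆⁆ + ⁅B, ⁅B, ⁅B, A⁆⁆⁆)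
      + (riemannZeta 2 ^ 2 / 2) • ⁅B, A⁆ ^ 2
      + ((2 * delta [3, 1] + 2 * delta [2, 1] * Real.log 2
        + (1 / 4) * Real.log 2 ^ 4 : ℝ) : ℂ) • ⁅A, ⁅B, ⁅B, A⁆⁆⁆ := by
    rw [coeff_four_associatorDelta A B rfl rfl rfl rfl rfl rfl rfl, riemannZeta_two_eq_polylog,
      polylog_two_at_one_eq_delta]
    push_cast
    rfl
  refine ⟨?_, hM, hD, ?_, linearIndependent_brackets, hg, ha⟩
  · intro s hs
    simp only [List.mem_cons, List.not_mem_nil, or_false] at hs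
    rcases hs with rfl | rfl | rfl | rfl | rfl | rfl <;> exact summable_delta
  -- Equality of the two terms follows from the numerical identities, not the other way round.
  · rw [hM, hD, ← ha, ← hg]
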